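/- **Hives.** Let $n$ be a positive integer. Take the triangular grid with vertices $(i,j)$, $0\le i\le j\le n$, and label its edges by integers: $\alpha_{ij}$ on the edge from $(i,j-1)$ to $(i,j)$ ($0\le i<j\le n$), $\beta_{ij}$ on the edge from $(i-1,j)$ to $(i,j)$, and $\gamma_{ij}$ on the edge from $(i-1,j-1)$ to $(i,j)$ ($1\le i\le j\le n$). Put $$R_{ij}=\alpha_{i-1,j-1}-\alpha_{ij},\qquad U_{ij}=\alpha_{ij}-\alpha_{i-1,j},\qquad L_{ij}=\beta_{i,j-1}-\beta_{i+1,j}\qquad(1\le i<j\le n).$$ The labelling is a *Littlewood–Richardson (LR) $n$-hive* if all its labels are $\ge 0$, if $\alpha_{i-1,j}+\beta_{ij}=\gamma_{ij}$ for $1\le i\le j\le n$ and $\beta_{i,j-1}+\alpha_{ij}=\gamma_{ij}$ for $1\le i<j\le n$, and if $R_{ij},U_{ij},L_{ij}\ge0$ for $1\le i<j\le n$. Its boundary labels are $\lambda_k=\gamma_{kk}$, $\mu_k=\alpha_{0k}$, $\nu_k=\beta_{kn}$ ($1\le k\le n$). Let $\mathcal H^{(n)}$ be the set of LR $n$-hives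 and $\mathcal H^{(n)}(\lambda,\mu,\nu)$ the subset with boundary labels $\lambda,\mu,\nu$. **Path removals.** For an LR $r$-hive with $\lambda_r>0$, a *path removal* is the following operation. (i) If $\nu_r>0$: decrease $\gamma_{rr}$ and $\beta_{rr}$ by $1$. (ii) If $\nu_r=0$ and $U_{ir}>0$ for some $i<r$: the path starts with the edges labelled $\gamma_{rr}$ and $\alpha_{r-1,r}$. Having reached $\alpha_{ij}$ with $i\ge1$, it continues with $\gamma_{ij},\alpha_{i-1,j}$ if $U_{ij}=0$, and with $\beta_{i,j-1},\alpha_{i-1,j-1}$ if $U_{ij}>0$; it stops on reaching some $\alpha_{0k}$. Decrease all $\alpha$- and $\gamma$-labels on the path by $1$ and increase all its $\beta$-labels by $1$. (iii) Otherwise (then $\mu_r>0$): decrease all $\alpha_{ir}$ ($0\le i<r$) and all $\gamma_{ir}$ ($1\le i\le r$) by $1$. Let $\theta_r$ act on an LR $r$-hive by performing $\lambda_r$ successive path removals (none if $\lambda_r=0$), where $\lambda_r$ is the label before the first of them, and let $V_{kr}$ ($1\le k<r$) be the number of those of type (ii) whose path ends at $\alpha_{0k}$. Let $\kappa_r$ delete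 the $r$th diagonal, i.e. all edges whose labels have second index $r$. **The map $\sigma^{(n)}$.** For $H\in\mathcal H^{(n)}(\lambda,\mu,\nu)$ set $H^{(n)}=H$ and $H^{(r-1)}=\kappa_r\theta_rH^{(r)}$ for $r=n,n-1,\dots,1$; let $V_{kr}$ be the numbers obtained in the action of $\theta_r$ on $H^{(r)}$, and let $\lambda_r$ and $\nu_r$ be the boundary labels $\gamma_{rr}$ and $\beta_{rr}$ of $H^{(r)}$. Set $\mu^{(n)}_k=\mu_k$ ($1\le k\le n$) and $\mu^{(r-1)}_k=\mu^{(r)}_k-V_{kr}$ ($1\le k<r$). Then $\sigma^{(n)}H$ is the labelling $K$ of the grid of size $n$ with $$\alpha_{ir}=\nu_r+\sum_{k=1}^{i}V_{kr}\quad(0\le i<r\le n),\qquad \beta_{kr}=\mu^{(r)}_k,\qquad \gamma_{rr}=\lambda_r\qquad(1\le k\le r\le n),$$ and with $\gamma_{kr}=\alpha_{k-1,r}+\beta_{kr}$ for $1\le k<r\le n$. **Theorem.** For every positive integer $n$ and every LR $n$-hive $H$, say $H\in\mathcal H^{(n)}(\lambda,\mu,\nu)$, the labelling $\sigma^{(n)}H$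 is an LR $n$-hive, it lies in $\mathcal H^{(n)}(\lambda,\nu,\mu)$, and $$(\sigma^{(n)})^2H=H.$$ -/

import Mathlib

/-- A labelling of the edges of a triangular grid by integers.  The grid of size `n` has the
vertices `(i, j)` with `0 ≤ i ≤ j ≤ n`, placed in the plane as `i • (1/2, -√3/2) + j • (1/2, √3/2)`.
Each label carries the index of the right-hand end of its edge:
`α i j` labels the edge from `(i, j-1)` to `(i, j)` (parallel to the left boundary, `i < j`),
`β i j` labels the edge from `(i-1, j)` to `(i, j)` (parallel to the right boundary, `1 ≤ i ≤ j`),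
`γ i j` labels the edge from `(i-1, j-1)` to `(i, j)` (parallel to the lower boundary,
`1 ≤ i ≤ j`). -/
@[ext]
structure EdgeLabelling where
  α : ℕ → ℕ → ℤ
  β : ℕ → ℕ → ℤ
  γ : ℕ → ℕ → ℤ

namespace EdgeLabelling

/-- Gradient of the right-leaning rhombus `(i, j)`. -/
def R (H : EdgeLabelling) (i j : ℕ) : ℤ := H.α (i - 1) (j - 1) - H.α i j

/-- Gradient of the upright rhombus `(i, j)`. -/
def U (H : EdgeLabelling) (i j : ℕ) : ℤ := H.α i j - H.α (i - 1) j

/-- Gradient of the left-leaning rhombus `(i, j)`. -/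
def L (H : EdgeLabelling) (i j : ℕ) : ℤ := H.β i (j - 1) - H.β (i + 1) j

/-- `H` is a Littlewood-Richardson `n`-hive in its edge representation: an integer edge labelling
of the grid of size `n` satisfying the triangle conditions and the rhombus inequalities, all of
whose labels are non-negative.  Since the labels are stored as functions on `ℕ × ℕ`, the positions
that are not edges of the grid carry the label `0`, so that distinct hives are distinct
labellings. -/
structure IsLRHive (n : ℕ) (H : EdgeLabelling) : Prop where
  alpha_off : ∀ i j, ¬ (i < j ∧ j ≤ n) → H.α i j = 0
  beta_off : ∀ i j, ¬ (1 ≤ i ∧ i ≤ j ∧ j ≤ n) → H.β i j = 0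
  gamma_off : ∀ i j, ¬ (1 ≤ i ∧ i ≤ j ∧ j ≤ n) → H.γ i j = 0
  triangle_up : ∀ i j, 1 ≤ i → i ≤ j → j ≤ n → H.α (i - 1) j + H.β i j = H.γ i j
  triangle_down : ∀ i j, 1 ≤ i → i < j → j ≤ n → H.β i (j - 1) + H.α i j = H.γ i j
  R_nonneg : ∀ i j, 1 ≤ i → i < j → j ≤ n → 0 ≤ H.R i j
  U_nonneg : ∀ i j, 1 ≤ i → i < j → j ≤ n → 0 ≤ H.U i j
  L_nonneg : ∀ i j, 1 ≤ i → i < j → j ≤ n → 0 ≤ H.L i j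
  alpha_nonneg : ∀ i j, i < j → j ≤ n → 0 ≤ H.α i j
  beta_nonneg : ∀ i j, 1 ≤ i → i ≤ j → j ≤ n → 0 ≤ H.β i j
  gamma_nonneg : ∀ i j, 1 ≤ i → i ≤ j → j ≤ n → 0 ≤ H.γ i j

/-- The lower boundary labels `λ_k`, from left to right. -/
def lam (H : EdgeLabelling) (k : ℕ) : ℤ := H.γ k k

/-- The left boundary labels `μ_k`, from bottom to top. -/
def mu (H : EdgeLabelling) (k : ℕ) : ℤ := H.α 0 k

/-- The right boundary labels `ν_k` of an `n`-hive, from top to bottom. -/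
def nu (n : ℕ) (H : EdgeLabelling) (k : ℕ) : ℤ := H.β k n

/-- Type (i) path removal: the labels `λ_r` and `ν_r` of an `r`-hive are decreased by `1`. -/
def chi (r : ℕ) (H : EdgeLabelling) : EdgeLabelling where
  α := H.α
  β i j := if i = r ∧ j = r then H.β i j - 1 else H.β i j
  γ i j := if i = r ∧ j = r then H.γ i j - 1 else H.γ i j

/-- Type (iii) path removal: all the `α`- and `γ`-labels in the `r`-th diagonal are decreased
by `1`. -/
def omega (r : ℕ) (H : EdgeLabelling) : EdgeLabelling where
  α i j := if i < r ∧ j = r then H.α i j - 1 else H.α i j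
  β := H.β
  γ i j := if 1 ≤ i ∧ i ≤ r ∧ j = r then H.γ i j - 1 else H.γ i j

/-- The diagonal in which the type (ii) path is found after `t` steps.  The path starts at the
foot of the `r`-th diagonal with the edges `γ r r` and `α (r-1) r`.  When it has reached the edge
`α i j` with `i = r - 1 - t ≥ 1`, the upright rhombus `(i, j)` is the next one above: if its
gradient is positive, the path moves left across `β i (j-1)` to `α (i-1) (j-1)`, in the diagonal
`j - 1`; if its gradient is `0`, the path goes up through `γ i j` to `α (i-1) j`. -/
def pathDiagAfter (r : ℕ) (H : EdgeLabelling) : ℕ → ℕ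
  | 0 => r
  | t + 1 =>
    if 0 < H.U (r - 1 - t) (pathDiagAfter r H t) then pathDiagAfter r H t - 1
    else pathDiagAfter r H t

/-- The index `j` of the unique edge `α i j` on the type (ii) path, for `0 ≤ i < r`. -/
def pathDiag (r : ℕ) (H : EdgeLabelling) (i : ℕ) : ℕ := pathDiagAfter r H (r - 1 - i)

/-- Type (ii) path removal: the labels of the `α`- and `γ`-edges on the path are decreased by `1`,
those of its `β`-edges are increased by `1`. -/
def phi (r : ℕ) (H : EdgeLabelling) : EdgeLabelling where
  α i j := if i < r ∧ j = pathDiag r H i then H.α i j - 1 else H.α i j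
  β i j :=
    if 1 ≤ i ∧ i < r ∧ 0 < H.U i (pathDiag r H i) ∧ j + 1 = pathDiag r H i then H.β i j + 1
    else H.β i j
  γ i j :=
    if (i = r ∧ j = r) ∨
        (1 ≤ i ∧ i < r ∧ ¬ 0 < H.U i (pathDiag r H i) ∧ j = pathDiag r H i) then
      H.γ i j - 1
    else H.γ i j

/-- The next path removal from the `r`-hive `H` is of type (ii). -/
def IsTypeTwo (r : ℕ) (H : EdgeLabelling) : Prop :=
  ¬ 0 < H.nu r r ∧ ∃ i ∈ Finset.Ico 1 r, 0 < H.U i r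

instance (r : ℕ) (H : EdgeLabelling) : Decidable (IsTypeTwo r H) := by
  unfold IsTypeTwo; infer_instance

/-- One path removal `θ_{r, λ_r}` from an `r`-hive. -/
def removePath (r : ℕ) (H : EdgeLabelling) : EdgeLabelling :=
  if 0 < H.nu r r then chi r H
  else if IsTypeTwo r H then phi r H
  else if 0 < H.mu r then omega r H
  else H

/-- The full path removal operator `θ_r = θ_{r,1} θ_{r,2} ⋯ θ_{r,λ_r}`: exactly `λ_r` successive
path removals. -/
def theta (r : ℕ) (H : EdgeLabelling) : EdgeLabelling :=
  (removePath r)^[(H.lam r).toNat] H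

/-- `V_{kr}`: the number of type (ii) path removals in the action of `θ_r` on `H` whose path ends
on the left boundary at the edge `α 0 k`. -/
def V (r : ℕ) (H : EdgeLabelling) (k : ℕ) : ℕ :=
  ((Finset.range (H.lam r).toNat).filter fun t =>
    IsTypeTwo r ((removePath r)^[t] H) ∧ pathDiag r ((removePath r)^[t] H) 0 = k).card

/-- Deletion of the `r`-th diagonal of an `r`-hive: only the grid of size `r - 1` is kept. -/
def kappa (r : ℕ) (H : EdgeLabelling) : EdgeLabelling where
  α i j := if j < r then H.α i j else 0
  β i j := if j < r then H.β i j else 0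
  γ i j := if j < r then H.γ i j else 0

/-- Adds to the left-hand boundary of the `r`-truncated hive `K` (the diagonals `r + 1, …, n` of
an `n`-hive, with left-hand boundary labels `β k r`) an `r`-th diagonal with label `a` at its top
(`α 0 r`), label `c` at its bottom (`γ r r`) and upright rhombus gradients `v k`, `1 ≤ k < r`.
The new left-hand boundary labels are `β k (r-1) = β k r - v k`, and the internal `γ`-labels are
given by the triangle condition. -/
def addDiagonal (r : ℕ) (a c : ℤ) (v : ℕ → ℤ) (K : EdgeLabelling) : EdgeLabelling where
  α i j := if i < r ∧ j = r then a + ∑ k ∈ Finset.Icc 1 i, v k else K.α i j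
  β i j := if 1 ≤ i ∧ i < r ∧ j + 1 = r then K.β i r - v i else K.β i j
  γ i j :=
    if i = r ∧ j = r then c
    else if 1 ≤ i ∧ i < r ∧ j = r then (a + ∑ k ∈ Finset.Icc 1 (i - 1), v k) + K.β i r
    else K.γ i j

/-- The operator `Θ_r`, taking the pair `(H^(r), K^(n-r))` to `(H^(r-1), K^(n-r+1))`. -/
def Theta (r : ℕ) (p : EdgeLabelling × EdgeLabelling) : EdgeLabelling × EdgeLabelling :=
  (kappa r (theta r p.1),
    addDiagonal r (p.1.nu r r) (p.1.lam r) (fun k => (V r p.1 k : ℤ)) p.2)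

/-- The composite `Θ_1 Θ_2 ⋯ Θ_r`, in which `Θ_r` acts first. -/
def ThetaAll : ℕ → EdgeLabelling × EdgeLabelling → EdgeLabelling × EdgeLabelling
  | 0, p => p
  | r + 1, p => ThetaAll r (Theta (r + 1) p)

/-- The empty `n`-truncated `n`-hive `K^(0)`: a single line of `β`-edges with the labels
`μ_1, …, μ_n` of the left boundary of `H`. -/
def emptyTruncated (n : ℕ) (H : EdgeLabelling) : EdgeLabelling where
  α _ _ := 0
  β i j := if 1 ≤ i ∧ i ≤ n ∧ j = n then H.mu i else 0
  γ _ _ := 0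

/-- The hive commutativity map `σ^(n)`: the second component of
`Θ_1 Θ_2 ⋯ Θ_n (H, K^(0))`. -/
def sigma (n : ℕ) (H : EdgeLabelling) : EdgeLabelling :=
  (ThetaAll n (H, emptyTruncated n H)).2

end EdgeLabelling

/-! The `α`-labels of an `r`-hive form a Gelfand-Tsetlin pattern, and a path removal of type (ii) or
(iii) is a jeu de taquin slide in it; type (i) leaves the pattern alone. A slide does not change the
promotion of a pattern (`IsSlidePath.isPromotion_of_slide`). After all removals the last diagonal
vanishes, and promotion is then mere deletion. So `κ_r θ_r` acts on the `α`-labels as promotion, a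
piecewise linear map, and `σ` records the rows `0` of the successive promotions `a s` of `H.α`: they
are the `β`-labels of `σ H`.

Put `c m = λ_m - ν_m` and `G i j r = ∑ (a r i m - c m)`, summed over `i < m ≤ j`. The recurrence for
promotion says that `G` solves the octahedron recurrence, and the hive conditions make it vanish for
`j = i` and `j = r`. The face `r = n` carries the `α`-labels of `H`, the face `i = 0` the `β`-labels
of `σ H`. The recurrence and the face `r = n` determine `G`.

The symmetry of the theorem is a duality that exchanges these two faces
(`IsOctahedronArray.exists_dual`). It is obtained by tropicalization: over Laurent series there is a
matrix whose flag minors on column intervals `[a, b)` have order `-G 0 a b`. By Plücker relations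
the minors on `[0, i) ∪ [j, r)` have order `-G i j r`, and the minors on `[i, j) ∪ [r, n)` give a
second solution `G'`. On `G'` the face `r = n` carries the `α`-labels of `σ H` and the face `i = 0`
the `β`-labels of `H`.

Both claims follow. The rows `0` belonging to `G'` interlace because `H` is a hive, which forces the
rhombus inequalities of `σ H` that are not immediate. The octahedron array of `σ H` agrees with `G'`
on the face `r = n`, hence everywhere, so applying `σ` again returns the `β`-labels of `H`, and with
them `H`. -/

/-! ### Flag minors and three-term Plücker relations -/

/-- The determinant of the first `m` rows of the matrix with the columns `l`. -/
def listMinor {F : Type*} [CommRing F] (m : ℕ) (l : List (ℕ → F)) : F :=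
  (Matrix.of fun i j : Fin m => l.getD j 0 i).det

section Minors

variable {F : Type*} [CommRing F]

theorem listMinor_swap (m : ℕ) (l₁ l₂ : List (ℕ → F)) (a b : ℕ → F) (h : l₁.length + 1 < m) :
    listMinor m (l₁ ++ a :: b :: l₂) = -listMinor m (l₁ ++ b :: a :: l₂) := by
  unfold listMinor
  have hne : (⟨l₁.length, by omega⟩ : Fin m) ≠ ⟨l₁.length + 1, h⟩ := by
    simp
  have := Matrix.det_permute' (Equiv.swap (⟨l₁.length, by omega⟩ : Fin m) ⟨l₁.length + 1, h⟩)
    (Matrix.of fun i j : Fin m => (l₁ ++ b :: a :: l₂).getD j 0 i)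
  rw [Equiv.Perm.sign_swap hne] at this
  simp only [Units.val_neg, Units.val_one, Int.cast_neg, Int.cast_one, neg_mul, one_mul] at this
  rw [← this]
  congr 1
  ext i j
  simp only [Matrix.of_apply, Matrix.submatrix_apply, id]
  by_cases h1 : j = ⟨l₁.length, by omega⟩
  · subst h1
    simp
  by_cases h2 : j = ⟨l₁.length + 1, h⟩
  · subst h2
    simp
  rw [Equiv.swap_apply_of_ne_of_ne h1 h2]
  have h1' : (j : ℕ) ≠ l₁.length := fun e => h1 (Fin.ext e)
  have h2' : (j : ℕ) ≠ l₁.length + 1 := fun e => h2 (Fin.ext e)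
  rcases lt_or_ge (j : ℕ) l₁.length with hlt | hge
  · simp [List.getElem?_append, hlt]
  · obtain ⟨t, ht⟩ : ∃ t, (j : ℕ) = l₁.length + (t + 2) := ⟨j - l₁.length - 2, by omega⟩
    simp [List.getElem?_append, ht]

theorem listMinor_move (m : ℕ) (l₁ l₂ l₃ : List (ℕ → F)) (a : ℕ → F)
    (h : l₁.length + l₂.length < m) :
    listMinor m (l₁ ++ (l₂ ++ a :: l₃)) = (-1) ^ l₂.length * listMinor m (l₁ ++ a :: (l₂ ++ l₃)) := by
  induction l₂ generalizing l₁ with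
  | nil => simp
  | cons b l₂ ih =>
    have := ih (l₁ ++ [b]) (by simp at h ⊢; omega)
    simp only [List.append_assoc, List.cons_append, List.nil_append] at this
    simp only [List.cons_append, List.length_cons]
    rw [this, listMinor_swap m l₁ _ b a (by simp at h; omega)]
    ring

/-- Bring the columns `x` and `y` to the front. -/
theorem listMinor_front_two (m : ℕ) (l₁ l₂ l₃ : List (ℕ → F)) (x y : ℕ → F)
    (h : l₁.length + l₂.length + 1 < m) :
    listMinor m (l₁ ++ x :: (l₂ ++ y :: l₃)) =
      (-1) ^ l₁.length * (-1) ^ (l₁.length + l₂.length) *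
        listMinor m (x :: y :: (l₁ ++ (l₂ ++ l₃))) := by
  have h1 := listMinor_move m [] l₁ (l₂ ++ y :: l₃) x (by simp; omega)
  have h2 := listMinor_move m [x] (l₁ ++ l₂) l₃ y (by simp; omega)
  simp only [List.nil_append, List.cons_append, List.append_assoc, List.length_append] at h1 h2
  rw [h1, h2, mul_assoc]

theorem listMinor_snoc_single (m : ℕ) (l : List (ℕ → F)) (h : l.length = m) (c : F) :
    listMinor (m + 1) (l ++ [Pi.single m c]) = c * listMinor m l := by
  unfold listMinor
  rw [Matrix.det_succ_column _ (Fin.last m), Fin.sum_univ_castSucc, Finset.sum_eq_zero]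
  · have : (m + m : ℕ) = 2 * m := by ring
    simp only [Matrix.of_apply, Fin.val_last, zero_add, this, pow_mul]
    simp only [even_two, Even.neg_pow, one_pow, one_mul]
    congr 1
    · simp [← h]
    · congr 1
      ext i j
      simp [List.getElem?_append, h]
  · intro i _
    have : (i : ℕ) ≠ m := i.2.ne
    simp [← h] at this ⊢
    simp [this]

theorem listMinor_snoc_add (m : ℕ) (l : List (ℕ → F)) (h : l.length = m) (u v : ℕ → F) :
    listMinor (m + 1) (l ++ [u + v]) = listMinor (m + 1) (l ++ [u]) + listMinor (m + 1) (l ++ [v]) := by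
  unfold listMinor
  have key : ∀ w : ℕ → F, (Matrix.of fun i j : Fin (m + 1) => (l ++ [w]).getD j 0 i) =
      (Matrix.of fun i j : Fin (m + 1) => (l ++ [0]).getD j 0 i).updateCol (Fin.last m)
        (fun i => w i) := by
    intro w
    ext i j
    refine Fin.lastCases ?_ (fun j => ?_) j
    · simp [← h]
    · simp [List.getElem?_append, h, (Fin.castSucc_lt_last j).ne]
  rw [key (u + v), key u, key v]
  exact Matrix.det_updateCol_add _ _ _ _

theorem listMinor_congr (m : ℕ) (l l' : List (ℕ → F))
    (h : ∀ i j, i < m → j < m → l.getD j 0 i = l'.getD j 0 i) : listMinor m l = listMinor m l' := by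
  unfold listMinor
  congr 1
  ext i j
  exact h i j i.2 j.2

-- Cramer's rule writes `det (M a b) • c` as a combination of the columns of `M a b`. Substituted
-- for the first column of `M c e`, the columns from `l` contribute nothing, being repeated; only
-- `a` and `b` survive.
open Matrix in
theorem listMinor_plucker (m : ℕ) (l : List (ℕ → F)) (a b c e : ℕ → F) :
    listMinor (m + 2) (a :: b :: l) * listMinor (m + 2) (c :: e :: l) +
      listMinor (m + 2) (b :: c :: l) * listMinor (m + 2) (a :: e :: l) =
    listMinor (m + 2) (a :: c :: l) * listMinor (m + 2) (b :: e :: l) := by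
  set ω : (ℕ → F) → (ℕ → F) → F := fun x y => listMinor (m + 2) (x :: y :: l) with hω
  let M : (ℕ → F) → (ℕ → F) → Matrix (Fin (m + 2)) (Fin (m + 2)) F :=
    fun x y => Matrix.of fun i j => (x :: y :: l).getD j 0 i
  let r : (ℕ → F) → Fin (m + 2) → F := fun x i => x i
  have upd0 : ∀ x y z, (M x y).updateCol 0 (r z) = M z y := by
    intro x y z
    ext i j
    refine Fin.cases ?_ (fun j => ?_) j
    · simp [M, r]
    · simp [M]
  have upd1 : ∀ x y z, (M x y).updateCol 1 (r z) = M x z := by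
    intro x y z
    ext i j
    refine Fin.cases ?_ (fun j => ?_) j
    · simp [M]
    · refine Fin.cases ?_ (fun j => ?_) j
      · simp [M, r]
      · simp [M, Fin.ext_iff]
  have hdet : ∀ x y, (M x y).det = ω x y := fun x y => rfl
  have hanti : ∀ x y, ω x y = -ω y x := fun x y => listMinor_swap (m + 2) [] l x y (by simp)
  -- Cramer's rule for the column `c` in terms of the columns of `M a b`.
  have hcr := Matrix.mulVec_cramer (M a b) (r c)
  have hlin : (M c e).cramer (M a b *ᵥ (M a b).cramer (r c)) 0 = ω a b * ω c e := by
    rw [hcr, map_smul, Pi.smul_apply, Matrix.cramer_apply, upd0, hdet, hdet, smul_eq_mul]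
  have hcol0 : (M a b)ᵀ 0 = r a := by ext i; simp [M, r]
  have hcol1 : (M a b)ᵀ 1 = r b := by ext i; simp [M, r]
  have hrest : ∀ k : Fin m, (M c e).cramer ((M a b)ᵀ k.succ.succ) 0 = 0 := by
    intro k
    rw [Matrix.cramer_apply]
    refine Matrix.det_zero_of_column_eq (i := 0) (j := k.succ.succ) (Fin.succ_ne_zero _).symm ?_
    intro i
    simp [M]
  rw [Matrix.mulVec_eq_sum, map_sum, Finset.sum_apply, Fin.sum_univ_succ, Fin.sum_univ_succ,
    Finset.sum_eq_zero] at hlin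
  · simp only [op_smul_eq_smul, map_smul, Pi.smul_apply, smul_eq_mul, Fin.succ_zero_eq_one,
      hcol0, hcol1] at hlin
    rw [Matrix.cramer_apply, Matrix.cramer_apply, Matrix.cramer_apply, Matrix.cramer_apply,
      upd0, upd0, upd0, upd1, hdet, hdet, hdet, hdet] at hlin
    rw [hanti c b] at hlin
    linear_combination -hlin
  · intro k _
    rw [op_smul_eq_smul, map_smul, Pi.smul_apply, hrest, smul_zero]

end Minors

section Columns

variable {F : Type*}

/-- The columns with indices in `[p, q)`. -/
def colSeg (x : ℕ → ℕ → F) (p q : ℕ) : List (ℕ → F) := (List.range' p (q - p)).map x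

theorem length_colSeg (x : ℕ → ℕ → F) (p q : ℕ) : (colSeg x p q).length = q - p := by
  simp [colSeg]

theorem colSeg_self (x : ℕ → ℕ → F) (p : ℕ) : colSeg x p p = [] := by
  simp [colSeg]

theorem colSeg_succ_right (x : ℕ → ℕ → F) {p q : ℕ} (h : p ≤ q) :
    colSeg x p (q + 1) = colSeg x p q ++ [x q] := by
  simp only [colSeg, Nat.succ_sub h, List.range'_concat, List.map_append]
  simp [Nat.add_sub_cancel' h]

theorem colSeg_cons (x : ℕ → ℕ → F) {p q : ℕ} (h : p < q) :
    colSeg x p q = x p :: colSeg x (p + 1) q := by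
  obtain ⟨d, rfl⟩ := Nat.exists_eq_add_of_lt h
  simp only [colSeg]
  rw [show p + d + 1 - p = d + 1 by omega, show p + d + 1 - (p + 1) = d by omega,
    List.range'_succ, List.map_cons]

theorem colSeg_append (x : ℕ → ℕ → F) {p q r : ℕ} (h : p ≤ q) (h' : q ≤ r) :
    colSeg x p q ++ colSeg x q r = colSeg x p r := by
  induction r, h' using Nat.le_induction with
  | base => simp [colSeg_self]
  | succ r hr ih => rw [colSeg_succ_right x hr, colSeg_succ_right x (h.trans hr), ← ih,
      List.append_assoc]

end Columns

section Minors

variable {F : Type*} [CommRing F]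

/-- Three-term Plücker relation between flag minors. -/
theorem listMinor_flag_plucker (k : ℕ) (B₁ B₂ B₃ B₄ : List (ℕ → F)) (a b c : ℕ → F)
    (hk : B₁.length + B₂.length + B₃.length + B₄.length = k) :
    listMinor (k + 1) (B₁ ++ (B₂ ++ b :: (B₃ ++ B₄))) *
        listMinor (k + 2) (B₁ ++ a :: (B₂ ++ (B₃ ++ c :: B₄))) =
      listMinor (k + 1) (B₁ ++ a :: (B₂ ++ (B₃ ++ B₄))) *
        listMinor (k + 2) (B₁ ++ (B₂ ++ b :: (B₃ ++ c :: B₄))) +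
      listMinor (k + 1) (B₁ ++ (B₂ ++ (B₃ ++ c :: B₄))) *
        listMinor (k + 2) (B₁ ++ a :: (B₂ ++ b :: (B₃ ++ B₄))) := by
  -- Appending this unit column turns the minors of size `k + 1` into minors of size `k + 2`, so
  -- that the relation becomes one between minors of equal size.
  set e : ℕ → F := Pi.single (k + 1) 1
  have snoc : ∀ l : List (ℕ → F), l.length = k + 1 →
      listMinor (k + 1) l = listMinor (k + 2) (l ++ [e]) := by
    intro l hl
    rw [listMinor_snoc_single (k + 1) l hl 1, one_mul]
  rw [snoc (B₁ ++ (B₂ ++ b :: (B₃ ++ B₄))) (by simp; omega),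
    snoc (B₁ ++ a :: (B₂ ++ (B₃ ++ B₄))) (by simp; omega),
    snoc (B₁ ++ (B₂ ++ (B₃ ++ c :: B₄))) (by simp; omega)]
  have h1 := listMinor_front_two (k + 2) (B₁ ++ B₂) (B₃ ++ B₄) [] b e (by simp; omega)
  have h2 := listMinor_front_two (k + 2) B₁ (B₂ ++ B₃) B₄ a c (by simp; omega)
  have h3 := listMinor_front_two (k + 2) B₁ (B₂ ++ (B₃ ++ B₄)) [] a e (by simp; omega)
  have h4 := listMinor_front_two (k + 2) (B₁ ++ B₂) B₃ B₄ b c (by simp; omega)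
  have h5 := listMinor_front_two (k + 2) (B₁ ++ (B₂ ++ B₃)) B₄ [] c e (by simp; omega)
  have h6 := listMinor_front_two (k + 2) B₁ B₂ (B₃ ++ B₄) a b (by simp; omega)
  simp only [List.append_assoc, List.cons_append, List.append_nil, List.length_append]
    at h1 h2 h3 h4 h5 h6 ⊢
  rw [h1, h2, h3, h4, h5, h6]
  have hp := listMinor_plucker k (B₁ ++ (B₂ ++ (B₃ ++ B₄))) a b c e
  simp only [pow_add]
  -- All three products acquire the same sign from the reordering of columns.
  linear_combination (-((-1) ^ B₁.length) ^ 4 * ((-1) ^ B₂.length) ^ 3 * ((-1) ^ B₃.length) ^ 2 *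
    (-1) ^ B₄.length) * hp

/-- The flag minor with the columns `[p, q) ∪ [r, s)`. -/
def segMinor (x : ℕ → ℕ → F) (p q r s : ℕ) : F :=
  listMinor ((q - p) + (s - r)) (colSeg x p q ++ colSeg x r s)

theorem segMinor_left_empty (x : ℕ → ℕ → F) (p r s : ℕ) :
    segMinor x p p r s = listMinor (s - r) (colSeg x r s) := by
  simp [segMinor, colSeg_self]

theorem segMinor_right_empty (x : ℕ → ℕ → F) (p q r : ℕ) :
    segMinor x p q r r = listMinor (q - p) (colSeg x p q) := by
  simp [segMinor, colSeg_self]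

theorem segMinor_adjacent (x : ℕ → ℕ → F) {p q s : ℕ} (h : p ≤ q) (h' : q ≤ s) :
    segMinor x p q q s = listMinor (s - p) (colSeg x p s) := by
  rw [segMinor, colSeg_append x h h', show q - p + (s - q) = s - p by omega]

/-- For `p = 0` this is the octahedron recurrence, tropicalized, for the minors on `[0, i) ∪ [j,
r)`. -/
theorem segMinor_plucker_right (x : ℕ → ℕ → F) {p q r s : ℕ} (h₁ : p ≤ q) (h₂ : r < s) :
    segMinor x p q r s * segMinor x p (q + 1) (r + 1) (s + 1) =
      segMinor x p q r (s + 1) * segMinor x p (q + 1) (r + 1) s +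
        segMinor x p q (r + 1) (s + 1) * segMinor x p (q + 1) r s := by
  have := listMinor_flag_plucker (q - p + (s - (r + 1))) (colSeg x p q) [] (colSeg x (r + 1) s) []
    (x q) (x r) (x s) (by simp [length_colSeg])
  simp only [segMinor, colSeg_succ_right x h₁, colSeg_succ_right x (h₂.le : r ≤ s),
    colSeg_succ_right x (h₂ : r + 1 ≤ s), colSeg_cons x h₂]
  rw [show q - p + (s - r) = q - p + (s - (r + 1)) + 1 by omega,
    show q + 1 - p + (s + 1 - (r + 1)) = q - p + (s - (r + 1)) + 2 by omega,
    show q - p + (s + 1 - r) = q - p + (s - (r + 1)) + 2 by omega,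
    show q + 1 - p + (s - (r + 1)) = q - p + (s - (r + 1)) + 1 by omega,
    show q - p + (s + 1 - (r + 1)) = q - p + (s - (r + 1)) + 1 by omega,
    show q + 1 - p + (s - r) = q - p + (s - (r + 1)) + 2 by omega]
  simp only [List.append_nil, List.nil_append, List.append_assoc, List.cons_append] at this ⊢
  rw [this]
  ring

/-- For `s = n` this is the octahedron recurrence of the dual array, from the minors on `[i, j) ∪
[r, n)`. -/
theorem segMinor_plucker_left (x : ℕ → ℕ → F) {p q r s : ℕ} (h₁ : p < q) (h₂ : r < s) :
    segMinor x p q r s * segMinor x (p + 1) (q + 1) (r + 1) s =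
      segMinor x p q (r + 1) s * segMinor x (p + 1) (q + 1) r s +
        segMinor x p (q + 1) (r + 1) s * segMinor x (p + 1) q r s := by
  have := listMinor_flag_plucker (q - (p + 1) + (s - (r + 1))) [] (colSeg x (p + 1) q) []
    (colSeg x (r + 1) s) (x p) (x q) (x r) (by simp [length_colSeg])
  simp only [segMinor, colSeg_succ_right x (h₁ : p + 1 ≤ q), colSeg_succ_right x h₁.le,
    colSeg_cons x h₂, colSeg_cons x h₁]
  rw [show q - p + (s - r) = q - (p + 1) + (s - (r + 1)) + 2 by omega,
    show q + 1 - (p + 1) + (s - (r + 1)) = q - (p + 1) + (s - (r + 1)) + 1 by omega,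
    show q - p + (s - (r + 1)) = q - (p + 1) + (s - (r + 1)) + 1 by omega,
    show q + 1 - (p + 1) + (s - r) = q - (p + 1) + (s - (r + 1)) + 2 by omega,
    show q + 1 - p + (s - (r + 1)) = q - (p + 1) + (s - (r + 1)) + 2 by omega,
    show q - (p + 1) + (s - r) = q - (p + 1) + (s - (r + 1)) + 1 by omega]
  simp only [List.nil_append, List.append_assoc, List.cons_append] at this ⊢
  linear_combination this

end Minors

/-! ### Matrices with prescribed solid flag minors -/

/-- A triangular system of equations for the entries of an array has a solution. -/
theorem exists_triangular_fixedPoint {F : Type*} [Zero F] (g : (ℕ → ℕ → F) → ℕ → ℕ → F)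
    (hg : ∀ x y m k, (∀ m' k', m' + k' < m + k → x m' k' = y m' k') → g x m k = g y m k) :
    ∃ x, ∀ m k, g x m k = x m k := by
  -- Starting from `0`, the entries with `m + k < N` are final after `N` iterations.
  have stable : ∀ N M m k, m + k < N → N ≤ M → g^[M] 0 m k = g^[N] 0 m k := by
    intro N
    induction N with
    | zero => intro M m k h; omega
    | succ N ih =>
      intro M m k h hM
      obtain ⟨M, rfl⟩ : ∃ M', M = M' + 1 := ⟨M - 1, by omega⟩
      rw [Function.iterate_succ_apply', Function.iterate_succ_apply']
      exact hg _ _ _ _ fun m' k' h' => ih M m' k' (by omega) (by omega)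
  refine ⟨fun m k => g^[m + k + 1] 0 m k, fun m k => ?_⟩
  dsimp only
  rw [Function.iterate_succ_apply']
  exact hg _ _ _ _ fun m' k' h' => (stable _ (m + k) m' k' (by omega) (by omega)).symm

/-- A matrix is determined by its solid flag minors, which can be prescribed. -/
theorem exists_listMinor_colSeg_eq {F : Type*} [Field F] (c : ℕ → ℕ → F) (h0 : ∀ a, c a 0 = 1)
    (hc : ∀ a k, c a k ≠ 0) :
    ∃ x : ℕ → ℕ → F, ∀ a k, listMinor k (colSeg x a (a + k)) = c a k := by
  have hget : ∀ (x : ℕ → ℕ → F) (p q j : ℕ), j < q - p → (colSeg x p q).getD j 0 = x (p + j) := by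
    intro x p q j hj
    simp [colSeg, hj]
  -- The minor of size `k + 1` that ends in column `m` is affine in its corner entry `x m k`, with
  -- the minor of size `k` on the preceding columns as coefficient. Solving for the corner uses only
  -- entries of smaller `m + k`. The truncated `m - k` for `k > m` is harmless: those entries lie in
  -- none of the minors prescribed.
  obtain ⟨x, hx⟩ := exists_triangular_fixedPoint (fun (x : ℕ → ℕ → F) m k =>
    (c (m - k) (k + 1) - listMinor (k + 1)
      (colSeg x (m - k) m ++ [fun i => if i < k then x m i else 0])) /
        listMinor k (colSeg x (m - k) m)) (by
    intro x y m k h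
    congr 1
    · congr 1
      refine listMinor_congr _ _ _ fun i j hi hj => ?_
      rcases lt_or_ge j (m - (m - k)) with hlt | hge
      · rw [List.getD_append _ _ _ _ (by rwa [length_colSeg]),
          List.getD_append _ _ _ _ (by rwa [length_colSeg]), hget _ _ _ _ hlt, hget _ _ _ _ hlt]
        exact h _ _ (by omega)
      · rw [List.getD_append_right _ _ _ _ (by rwa [length_colSeg]),
          List.getD_append_right _ _ _ _ (by rwa [length_colSeg]), length_colSeg, length_colSeg]
        rcases Nat.eq_zero_or_pos (j - (m - (m - k))) with h' | h'
        · rw [h']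
          simp only [List.getD_cons_zero]
          split_ifs with hik
          · exact h _ _ (by omega)
          · rfl
        · obtain ⟨t, ht⟩ := Nat.exists_eq_add_of_lt h'
          rw [ht]
          simp
    · refine listMinor_congr _ _ _ fun i j hi hj => ?_
      rcases lt_or_ge j (m - (m - k)) with hlt | hge
      · rw [hget _ _ _ _ hlt, hget _ _ _ _ hlt]
        exact h _ _ (by omega)
      · rw [List.getD_eq_default _ _ (by rwa [length_colSeg]),
          List.getD_eq_default _ _ (by rwa [length_colSeg])])
  refine ⟨x, fun a k => ?_⟩
  induction k with
  | zero => simp [listMinor, h0]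
  | succ k ih =>
    have hx' := hx (a + k) k
    rw [Nat.add_sub_cancel, ih, div_eq_iff (hc a k)] at hx'
    rw [← Nat.add_assoc, colSeg_succ_right x (Nat.le_add_right a k)]
    have hlen : (colSeg x a (a + k)).length = k := by rw [length_colSeg]; omega
    have hsplit : listMinor (k + 1) (colSeg x a (a + k) ++ [x (a + k)]) =
        listMinor (k + 1) (colSeg x a (a + k) ++
          [(fun i => if i < k then x (a + k) i else 0) + Pi.single k (x (a + k) k)]) := by
      refine listMinor_congr _ _ _ fun i j hi hj => ?_
      rcases lt_or_ge j k with hlt | hge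
      · rw [List.getD_append _ _ _ _ (by rwa [hlen]), List.getD_append _ _ _ _ (by rwa [hlen])]
      · obtain rfl : j = k := by omega
        rw [List.getD_append_right _ _ _ _ hlen.le, List.getD_append_right _ _ _ _ hlen.le, hlen]
        simp only [Nat.sub_self, List.getD_cons_zero, Pi.add_apply]
        rcases lt_or_ge i j with h | h
        · simp [h, h.ne]
        · obtain rfl : i = j := by omega
          simp
    rw [hsplit, listMinor_snoc_add k _ hlen, listMinor_snoc_single k _ hlen, ih]
    linear_combination -hx'

/-! ### Tropicalization by orders of Laurent series -/

namespace HahnSeries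

/-- The least exponents of series with positive leading coefficients are tropical values. -/
theorem order_add_of_leadingCoeff_pos {x y : HahnSeries ℤ ℚ} (hx : 0 < x.leadingCoeff)
    (hy : 0 < y.leadingCoeff) :
    0 < (x + y).leadingCoeff ∧ (x + y).order = min x.order y.order := by
  have hx0 : x ≠ 0 := leadingCoeff_ne_zero.1 hx.ne'
  have hy0 : y ≠ 0 := leadingCoeff_ne_zero.1 hy.ne'
  rw [leadingCoeff_eq] at hx hy
  have key : 0 < (x + y).coeff (min x.order y.order) := by
    rw [coeff_add]
    rcases lt_trichotomy x.order y.order with h | h | h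
    · rw [min_eq_left h.le, coeff_eq_zero_of_lt_order h, add_zero]
      exact hx
    · rw [← h, min_self]
      rw [← h] at hy
      exact add_pos hx hy
    · rw [min_eq_right h.le, coeff_eq_zero_of_lt_order h, zero_add]
      exact hy
  have hne : x + y ≠ 0 := by
    intro h
    rw [h] at key
    simp at key
  have hord : (x + y).order = min x.order y.order :=
    le_antisymm (order_le_of_coeff_ne_zero key.ne') (min_order_le_order_add hne)
  rw [leadingCoeff_eq, hord]
  exact ⟨key, rfl⟩

/-- Positive leading coefficients exclude cancellation in `b * c + d * e`, and positivity passes to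
`x` by division; so it spreads along the recurrence. -/
theorem tropical_relation {a b c d e x : HahnSeries ℤ ℚ} (ha : 0 < a.leadingCoeff)
    (hb : 0 < b.leadingCoeff) (hc : 0 < c.leadingCoeff) (hd : 0 < d.leadingCoeff)
    (he : 0 < e.leadingCoeff) (h : a * x = b * c + d * e) :
    0 < x.leadingCoeff ∧
      -a.order + -x.order = max (-b.order + -c.order) (-d.order + -e.order) := by
  have hmul : ∀ {u v : HahnSeries ℤ ℚ}, 0 < u.leadingCoeff → 0 < v.leadingCoeff →
      0 < (u * v).leadingCoeff ∧ (u * v).order = u.order + v.order := fun {u v} hu hv =>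
    ⟨by rw [leadingCoeff_mul]; exact mul_pos hu hv,
      order_mul (leadingCoeff_ne_zero.1 hu.ne') (leadingCoeff_ne_zero.1 hv.ne')⟩
  have hs := order_add_of_leadingCoeff_pos (hmul hb hc).1 (hmul hd he).1
  rw [← h, (hmul hb hc).2, (hmul hd he).2, leadingCoeff_mul] at hs
  have hx : 0 < x.leadingCoeff := (mul_pos_iff_of_pos_left ha).1 hs.1
  refine ⟨hx, ?_⟩
  rw [(hmul ha hx).2] at hs
  omega

end HahnSeries

/-! ### The octahedron recurrence: uniqueness and duality -/

/-- Solutions of the octahedron recurrence in the tetrahedron `0 ≤ i ≤ j ≤ r ≤ n`, vanishing on two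
of its faces. -/
structure IsOctahedronArray (n : ℕ) (G : ℕ → ℕ → ℕ → ℤ) : Prop where
  wall_left : ∀ i r, i ≤ r → r ≤ n → G i i r = 0
  wall_right : ∀ i r, i ≤ r → r ≤ n → G i r r = 0
  octahedron : ∀ i j r, i < j → j < r → r < n →
    G i j r + G (i + 1) (j + 1) (r + 1) =
      max (G i j (r + 1) + G (i + 1) (j + 1) r) (G i (j + 1) (r + 1) + G (i + 1) j r)

namespace IsOctahedronArray

variable {n : ℕ} {G G' : ℕ → ℕ → ℕ → ℤ}

/-- Off the walls the recurrence yields `G i j r` from values at level `r + 1` and from values at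
level `r` with first index `i + 1`: induct downwards on `r`, then on `i`. -/
theorem eq_of_eq_face (hG : IsOctahedronArray n G) (hG' : IsOctahedronArray n G')
    (h : ∀ i j, i ≤ j → j ≤ n → G i j n = G' i j n) :
    ∀ i j r, i ≤ j → j ≤ r → r ≤ n → G i j r = G' i j r := by
  have main : ∀ d r, r + d = n → ∀ e i j, i + e = r → i ≤ j → j ≤ r → G i j r = G' i j r := by
    intro d
    induction d with
    | zero => rintro r rfl e i j - hij hjr; exact h i j hij hjr
    | succ d ihd =>
      intro r hr e
      induction e with
      | zero =>
        intro i j hi hij hjr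
        obtain rfl : i = j := by omega
        rw [hG.wall_left i r hjr (by omega), hG'.wall_left i r hjr (by omega)]
      | succ e ihe =>
        intro i j hi hij hjr
        rcases hij.eq_or_lt with rfl | hij
        · rw [hG.wall_left i r hjr (by omega), hG'.wall_left i r hjr (by omega)]
        rcases hjr.eq_or_lt with rfl | hjr
        · rw [hG.wall_right i j hij.le (by omega), hG'.wall_right i j hij.le (by omega)]
        have h1 := hG.octahedron i j r hij hjr (by omega)
        have h2 := hG'.octahedron i j r hij hjr (by omega)
        rw [ihd (r + 1) (by omega) (r + 1 - (i + 1)) (i + 1) (j + 1) (by omega) (by omega)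
            (by omega),
          ihd (r + 1) (by omega) (r + 1 - i) i j (by omega) (by omega) (by omega),
          ihd (r + 1) (by omega) (r + 1 - i) i (j + 1) (by omega) (by omega) (by omega),
          ihe (i + 1) (j + 1) (by omega) (by omega) (by omega),
          ihe (i + 1) j (by omega) (by omega) (by omega), ← h2] at h1
        omega
  exact fun i j r hij hjr hr => main (n - r) r (by omega) (r - i) i j (by omega) hij hjr

/-- The values of a solution on the face `i = 0` are the values of a second solution on the face
`r = n`, up to boundary terms, and conversely. -/
theorem exists_dual (hG : IsOctahedronArray n G) :
    ∃ G' : ℕ → ℕ → ℕ → ℤ, IsOctahedronArray n G' ∧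
      (∀ i j, i ≤ j → j ≤ n → G' i j n = G 0 i j + G 0 j n - G 0 i n) ∧
      (∀ i j, i ≤ j → j ≤ n → G' 0 i j = G i j n - G 0 j n + G 0 i n) := by
  -- The prescribed solid minors are monomials of exponent `-G 0 a (a + k)`; the empty minor has to
  -- be `1`.
  set c : ℕ → ℕ → HahnSeries ℤ ℚ := fun a k =>
    if k = 0 then 1 else HahnSeries.single (-(G 0 a (a + k))) 1 with hc
  have hcpos : ∀ a k, 0 < (c a k).leadingCoeff := by
    intro a k
    simp only [hc]
    split_ifs
    · simp
    · simp
  have hcord : ∀ a r, a ≤ r → r ≤ n → -(c a (r - a)).order = G 0 a r := by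
    intro a r har hr
    simp only [hc]
    split_ifs with h
    · obtain rfl : a = r := by omega
      rw [hG.wall_right 0 a (by omega) hr]
      simp
    · rw [HahnSeries.order_single one_ne_zero, Nat.add_sub_cancel' har, neg_neg]
  obtain ⟨x, hx⟩ := exists_listMinor_colSeg_eq c (fun a => by simp [hc])
    (fun a k => HahnSeries.leadingCoeff_ne_zero.1 (hcpos a k).ne')
  replace hx : ∀ a b, a ≤ b → listMinor (b - a) (colSeg x a b) = c a (b - a) := by
    intro a b hab
    have := hx a (b - a)
    rwa [Nat.add_sub_cancel' hab] at this
  have hleft : ∀ p r s, r ≤ s → segMinor x p p r s = c r (s - r) := fun p r s h => by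
    rw [segMinor_left_empty, hx r s h]
  have hright : ∀ p q r, p ≤ q → segMinor x p q r r = c p (q - p) := fun p q r h => by
    rw [segMinor_right_empty, hx p q h]
  have hadj : ∀ p q s, p ≤ q → q ≤ s → segMinor x p q q s = c p (s - p) := fun p q s h h' => by
    rw [segMinor_adjacent x h h', hx p s (h.trans h')]
  -- When the two segments touch or one is empty, the minor is solid, hence prescribed. All others
  -- follow from the Plücker relation without subtraction.
  have hpos : ∀ p d s r, p + d ≤ r → r ≤ s → 0 < (segMinor x p (p + d) r s).leadingCoeff := by
    intro p d
    induction d with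
    | zero => intro s r _ h; rw [add_zero, hleft p r s h]; exact hcpos _ _
    | succ d ihd =>
      intro s
      induction s with
      | zero =>
        intro r h h'
        omega
      | succ s ihs =>
        intro r h h'
        rcases h'.eq_or_lt with rfl | h'
        · rw [hright _ _ _ (by omega)]; exact hcpos _ _
        rcases h.eq_or_lt with rfl | h
        · rw [hadj _ _ _ (by omega) (by omega)]; exact hcpos _ _
        obtain ⟨r, rfl⟩ : ∃ r', r = r' + 1 := ⟨r - 1, by omega⟩
        exact (HahnSeries.tropical_relation (ihd s r (by omega) (by omega))
          (ihd (s + 1) r (by omega) (by omega)) (ihs (r + 1) (by omega) (by omega))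
          (ihd (s + 1) (r + 1) (by omega) (by omega)) (ihs r (by omega) (by omega))
          (segMinor_plucker_right x (Nat.le_add_right p d) (by omega))).1
  replace hpos : ∀ p q r s, p ≤ q → q ≤ r → r ≤ s → 0 < (segMinor x p q r s).leadingCoeff := by
    intro p q r s hpq hqr hrs
    obtain ⟨d, rfl⟩ := Nat.exists_eq_add_of_le hpq
    exact hpos p d s r hqr hrs
  -- Same induction as for `hpos`, now comparing orders with the octahedron recurrence of `G`.
  have hface : ∀ i r j, i ≤ j → j ≤ r → r ≤ n → -(segMinor x 0 i j r).order = G i j r := by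
    intro i
    induction i with
    | zero => intro r j _ h h'; rw [hleft 0 j r h, hcord j r h h']
    | succ i ihi =>
      intro r
      induction r with
      | zero => intro j h h'; omega
      | succ r ihr =>
        intro j hij hjr hr
        rcases hjr.eq_or_lt with rfl | hjr
        · rw [hright _ _ _ (by omega), hcord _ _ (by omega) (by omega),
            hG.wall_left 0 _ (by omega) (by omega), hG.wall_right _ _ hij hr]
        rcases hij.eq_or_lt with rfl | hij
        · rw [hadj _ _ _ (by omega) (by omega), hcord _ _ (by omega) (by omega),
            hG.wall_left 0 _ (by omega) (by omega), hG.wall_left _ _ hjr.le hr]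
        obtain ⟨j, rfl⟩ : ∃ j', j = j' + 1 := ⟨j - 1, by omega⟩
        have h1 := (HahnSeries.tropical_relation
          (hpos 0 i j r (by omega) (by omega) (by omega))
          (hpos 0 i j (r + 1) (by omega) (by omega) (by omega))
          (hpos 0 (i + 1) (j + 1) r (by omega) (by omega) (by omega))
          (hpos 0 i (j + 1) (r + 1) (by omega) (by omega) (by omega))
          (hpos 0 (i + 1) j r (by omega) (by omega) (by omega))
          (segMinor_plucker_right x (Nat.zero_le i) (by omega))).2
        have h2 := hG.octahedron i j r (by omega) (by omega) (by omega)
        rw [ihi r j (by omega) (by omega) (by omega),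
          ihi (r + 1) j (by omega) (by omega) (by omega),
          ihi (r + 1) (j + 1) (by omega) (by omega) (by omega),
          ihr (j + 1) (by omega) (by omega) (by omega),
          ihr j (by omega) (by omega) (by omega), ← h2] at h1
        omega
  -- The correction is a function of `i` plus one of `j` plus one of `r`, so it cancels in the
  -- recurrence; it is chosen to make both walls vanish.
  refine ⟨fun i j r => -(segMinor x i j r n).order - G 0 i n + G 0 j n - G 0 r n,
    ⟨?_, ?_, ?_⟩, ?_, ?_⟩
  · intro i r hir hr
    rw [hleft i r n hr, hcord r n hr le_rfl]
    ring
  · intro i r hir hr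
    rw [hadj i r n hir hr, hcord i n (by omega) le_rfl]
    ring
  · intro i j r hij hjr hr
    have h1 := (HahnSeries.tropical_relation
      (hpos i j r n (by omega) (by omega) (by omega))
      (hpos i j (r + 1) n (by omega) (by omega) (by omega))
      (hpos (i + 1) (j + 1) r n (by omega) (by omega) (by omega))
      (hpos i (j + 1) (r + 1) n (by omega) (by omega) (by omega))
      (hpos (i + 1) j r n (by omega) (by omega) (by omega))
      (segMinor_plucker_left x hij hr)).2
    omega
  · intro i j hij hj
    simp only
    rw [hright i j n hij, hcord i j hij hj, hG.wall_right 0 n (by omega) le_rfl]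
    ring
  · intro i j hij hj
    simp only
    rw [hface i n j hij hj le_rfl, hG.wall_left 0 n (by omega) le_rfl]
    ring

end IsOctahedronArray

/-! ### Gelfand-Tsetlin patterns, promotion and slides -/

/-- The inequalities between the entries `a i j`, `i < j ≤ r`, of a Gelfand-Tsetlin pattern. -/
structure IsGTPattern (r : ℕ) (a : ℕ → ℕ → ℤ) : Prop where
  up : ∀ i j, i + 1 < j → j ≤ r → a i j ≤ a (i + 1) j
  right : ∀ i j, i < j → j < r → a (i + 1) (j + 1) ≤ a i j

/-- The pattern `a'` of size `r - 1` is the promotion of the pattern `a` of size `r`. -/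
def IsPromotion (r : ℕ) (a a' : ℕ → ℕ → ℤ) : Prop :=
  ∀ i j, i < j → j < r → a' i j + a (i + 1) (j + 1) =
    (if j = i + 1 then a i j else min (a i j) (a' (i + 1) j)) +
      (if j + 1 = r then a i (j + 1) else max (a i (j + 1)) (a' (i + 1) (j + 1)))

/-- The path `d` of a jeu de taquin slide in the pattern `a`: it passes through the entries
`a i (d i)`, `i < r`, from the bottom `a (r - 1) r` upwards. -/
structure IsSlidePath (r : ℕ) (a : ℕ → ℕ → ℤ) (d : ℕ → ℕ) : Prop where
  start : ∀ i, i + 1 = r → d i = r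
  step : ∀ i, i + 1 < r →
    (d i = d (i + 1) ∧ a (i + 1) (d (i + 1)) = a i (d (i + 1))) ∨
      (d i + 1 = d (i + 1) ∧ a i (d (i + 1)) < a (i + 1) (d (i + 1)))

/-- Decrease the entries of `a` on the path `d` by `1`. -/
def slide (r : ℕ) (a : ℕ → ℕ → ℤ) (d : ℕ → ℕ) (i j : ℕ) : ℤ :=
  if i < r ∧ j = d i then a i j - 1 else a i j

theorem downward_induction {r : ℕ} {P : ℕ → Prop} (start : ∀ i, i + 1 = r → P i)
    (step : ∀ i, i + 1 < r → P (i + 1) → P i) : ∀ i, i < r → P i := by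
  have : ∀ e i, i + 1 + e = r → P i := by
    intro e
    induction e with
    | zero => exact start
    | succ e ih => intro i hi; exact step i (by omega) (ih (i + 1) (by omega))
  exact fun i hi => this (r - (i + 1)) i (by omega)

theorem IsPromotion.congr {r : ℕ} {a b b' : ℕ → ℕ → ℤ} (h : IsPromotion r a b)
    (hb : ∀ i j, j < r → b' i j = b i j) : IsPromotion r a b' := by
  intro i j hij hj
  have := h i j hij hj
  rw [hb i j hj, hb (i + 1) j hj, this]
  split_ifs with h1 h2 h2
  · rfl
  · rw [hb (i + 1) (j + 1) (by omega)]
  · rfl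
  · rw [hb (i + 1) (j + 1) (by omega)]

namespace IsGTPattern

variable {r : ℕ} {a a' : ℕ → ℕ → ℤ} {d : ℕ → ℕ}

/-- By induction from the bottom row, the `min` lies between `a (i + 1) (j + 1)` and `a i j`, the
`max` between `a i (j + 1)` and `a (i + 1) (j + 1)`. -/
theorem promotion_interlace (ha : IsGTPattern r a) (h : IsPromotion r a a') :
    ∀ i, i < r → ∀ j, i < j → j < r → a' i j ≤ a i j ∧ a i (j + 1) ≤ a' i j := by
  refine downward_induction (fun i hi j hij hj => by omega) fun i hi ih j hij hj => ?_
  have h0 := h i j hij hj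
  have h1 := ha.right i j hij hj
  have h2 := ha.up i (j + 1) (by omega) hj
  have h3 : j ≠ i + 1 → a (i + 1) (j + 1) ≤ a' (i + 1) j := fun hne =>
    (ih j (by omega) hj).2
  have h4 : j + 1 ≠ r → a' (i + 1) (j + 1) ≤ a (i + 1) (j + 1) := fun hne =>
    (ih (j + 1) (by omega) (by omega)).1
  split_ifs at h0 with c1 c2 c2
  · omega
  · specialize h4 c2; omega
  · specialize h3 c1; omega
  · specialize h3 c1; specialize h4 c2; omega

theorem promotion (ha : IsGTPattern (r + 1) a) (h : IsPromotion (r + 1) a a') :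
    IsGTPattern r a' := by
  have hi := ha.promotion_interlace h
  constructor
  · intro i j hij hj
    have h0 := h i j (by omega) (by omega)
    have h1 := ha.right i j (by omega) (by omega)
    have h2 := ha.up i (j + 1) (by omega) (by omega)
    rw [if_neg (by omega)] at h0
    split_ifs at h0 with c2
    · omega
    · have := (hi (i + 1) (by omega) (j + 1) (by omega) (by omega)).1
      omega
  · intro i j hij hj
    have h0 := h i j (by omega) (by omega)
    have h1 := ha.right i j (by omega) (by omega)
    rw [if_neg (show j + 1 ≠ r + 1 by omega)] at h0
    split_ifs at h0 with c1
    · omega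
    · have := (hi (i + 1) (by omega) j (by omega) (by omega)).2
      omega

/-- Once the last diagonal vanishes, promotion only deletes it. -/
theorem isPromotion_self (ha : IsGTPattern r a) (h : ∀ i, i < r → a i r = 0) :
    IsPromotion r a a := by
  intro i j hij hj
  have h1 : a i j ≤ a (i + 1) j ∨ j = i + 1 := by
    by_cases c : j = i + 1
    · exact Or.inr c
    · exact Or.inl (ha.up i j (by omega) (by omega))
  have h2 := ha.up i (j + 1) (by omega) (by omega)
  by_cases c2 : j + 1 = r
  · have e1 := h i (by omega)
    have e2 := h (i + 1) (by omega)
    rw [← c2] at e1 e2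
    rw [if_pos c2, e1, e2]
    split_ifs with c1
    · rfl
    · have := h1.resolve_right c1; omega
  · rw [if_neg c2]
    split_ifs with c1
    · omega
    · have := h1.resolve_right c1; omega

end IsGTPattern

namespace IsSlidePath

variable {r : ℕ} {a a' : ℕ → ℕ → ℤ} {d : ℕ → ℕ}

theorem lt_and_le (hd : IsSlidePath r a d) : ∀ i, i < r → i < d i ∧ d i ≤ r := by
  refine downward_induction (fun i hi => ?_) fun i hi ih => ?_
  · rw [hd.start i hi]; omega
  · have := hd.step i hi; omega

/-- Once the path has left the last diagonal, this gap is the slack that lets its entries drop by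
`1` within the pattern inequalities. -/
theorem lt_of_succ (hd : IsSlidePath r a d) (ha : IsGTPattern r a) :
    ∀ i, i < r → d i < r → a i (d i + 1) < a i (d i) := by
  refine downward_induction (fun i hi h => ?_) fun i hi ih h => ?_
  · rw [hd.start i hi] at h; omega
  · have hb := hd.lt_and_le (i + 1) hi
    rcases hd.step i hi with ⟨e, h1⟩ | ⟨e, h1⟩
    · rw [e] at h ⊢
      have := ih h
      have := ha.up i (d (i + 1) + 1) (by omega) (by omega)
      omega
    · rw [← e] at h1
      have := ha.right i (d i) (by omega) h
      rw [e] at this h1 ⊢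
      omega

/-- A path that ends in the last diagonal stays there. -/
theorem eq_of_eq_zero (hd : IsSlidePath r a d) (h : d 0 = r) :
    ∀ i, i < r → d i = r ∧ a i r = a 0 r := by
  intro i
  induction i with
  | zero => exact fun _ => ⟨h, rfl⟩
  | succ i ih =>
    intro hi
    have := ih (by omega)
    have hb := hd.lt_and_le (i + 1) hi
    rcases hd.step i hi with ⟨e, h1⟩ | ⟨e, h1⟩
    · have e' : d (i + 1) = r := by omega
      rw [e'] at h1
      omega
    · omega

theorem isGTPattern_slide (hd : IsSlidePath r a d) (ha : IsGTPattern r a) :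
    IsGTPattern r (slide r a d) := by
  constructor
  · intro i j hij hj
    have h1 := ha.up i j hij hj
    unfold slide
    rcases hd.step i (by omega) with ⟨e, h2⟩ | ⟨e, h2⟩
    · split_ifs <;> omega
    · by_cases c : j = d (i + 1)
      · subst c
        split_ifs <;> omega
      · split_ifs <;> omega
  · intro i j hij hj
    have h1 := ha.right i j hij hj
    unfold slide
    by_cases c : j = d i
    · have h3 := hd.lt_of_succ ha i (by omega) (by omega)
      rcases hd.step i (by omega) with ⟨e, h2⟩ | ⟨e, h2⟩
      · have h4 : a (i + 1) (j + 1) ≤ a (i + 1) j - 1 ∨ j = i + 1 := by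
          by_cases c' : j = i + 1
          · exact Or.inr c'
          · have := hd.lt_of_succ ha (i + 1) (by omega) (by omega)
            rw [← e, ← c] at this
            omega
        have := hd.lt_and_le (i + 1) (by omega)
        rw [← e, ← c] at h2
        split_ifs <;> omega
      · split_ifs <;> omega
    · split_ifs <;> omega

/-- The slide changes both sides of each recurrence by the same amount. Where the path goes up, `a'
< a` on the path makes the lowered entry of row `i` the maximum. Where it goes left, `a' = a` to the
left of the path makes the lowered entry the minimum. -/
theorem isPromotion_of_slide (hd : IsSlidePath r a d) (ha : IsGTPattern r a)
    (h : IsPromotion r (slide r a d) a') : IsPromotion r a a' := by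
  have hle : ∀ i, i < r → ∀ j, i < j → j < r → a' i j ≤ slide r a d i j := fun i hi j hij hj =>
    ((hd.isGTPattern_slide ha).promotion_interlace h i hi j hij hj).1
  have hlt : ∀ i, i < r → d i < r → a' i (d i) < a i (d i) := by
    intro i hi hr
    have := hle i hi (d i) (hd.lt_and_le i hi).1 hr
    simp only [slide, hi, true_and, if_true] at this
    omega
  -- Promotion fixes the entries to the left of the path; this is proved along with the recurrence
  -- because the next row up needs it.
  have main : ∀ i, i < r → (∀ j, i < j → j < d i → a' i j = a i j) ∧
      ∀ j, i < j → j < r → a' i j + a (i + 1) (j + 1) =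
        (if j = i + 1 then a i j else min (a i j) (a' (i + 1) j)) +
        (if j + 1 = r then a i (j + 1) else max (a i (j + 1)) (a' (i + 1) (j + 1))) := by
    refine downward_induction (fun i hi => ⟨fun j hij hj => ?_, fun j hij hj => by omega⟩)
      fun i hi ih => ?_
    · rw [hd.start i hi] at hj; omega
    · have b1 := hd.lt_and_le (i + 1) hi
      have b0 := hd.lt_and_le i (by omega)
      have hprom : ∀ j, i < j → j < r → a' i j + a (i + 1) (j + 1) =
          (if j = i + 1 then a i j else min (a i j) (a' (i + 1) j)) +
          (if j + 1 = r then a i (j + 1) else max (a i (j + 1)) (a' (i + 1) (j + 1))) := by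
        intro j hij hj
        have h0 := h i j hij hj
        have hl := hlt (i + 1) hi
        unfold slide at h0
        rcases hd.step i hi with ⟨e, h2⟩ | ⟨e, h2⟩
        · by_cases c1 : j + 1 = d (i + 1)
          · rw [← c1] at hl h2
            rw [if_pos (by omega), if_neg (show ¬(i < r ∧ j = d i) by omega),
              if_pos (show i < r ∧ j + 1 = d i by omega)] at h0
            split_ifs at h0 ⊢ <;> omega
          · by_cases c2 : j = d (i + 1)
            · rw [← c2] at hl h2
              rw [if_neg (by omega), if_pos (show i < r ∧ j = d i by omega),
                if_neg (show ¬(i < r ∧ j + 1 = d i) by omega)] at h0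
              split_ifs at h0 ⊢ <;> omega
            · rw [if_neg (by omega), if_neg (show ¬(i < r ∧ j = d i) by omega),
                if_neg (show ¬(i < r ∧ j + 1 = d i) by omega)] at h0
              exact h0
        · have hq : d i ≠ i + 1 → a i (d i) ≤ a' (i + 1) (d i) := by
            intro hne
            rw [ih.1 (d i) (by omega) (by omega)]
            exact ha.up i (d i) (by omega) (by omega)
          by_cases c1 : j = d i
          · rw [← c1] at hq
            rw [if_pos (by omega), if_pos (show i < r ∧ j = d i by omega),
              if_neg (show ¬(i < r ∧ j + 1 = d i) by omega)] at h0
            split_ifs at h0 ⊢ <;> omega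
          · by_cases c2 : j + 1 = d i
            · rw [← c2] at hq
              rw [if_neg (by omega), if_neg (show ¬(i < r ∧ j = d i) by omega),
                if_pos (show i < r ∧ j + 1 = d i by omega)] at h0
              split_ifs at h0 ⊢ <;> omega
            · rw [if_neg (by omega), if_neg (show ¬(i < r ∧ j = d i) by omega),
                if_neg (show ¬(i < r ∧ j + 1 = d i) by omega)] at h0
              exact h0
      refine ⟨fun j hij hj => ?_, hprom⟩
      have h0 := hprom j hij (by omega)
      have hle' : d i ≤ d (i + 1) := by have := hd.step i hi; omega
      have h1 : j ≠ i + 1 → a i j ≤ a' (i + 1) j := by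
        intro hne
        rw [ih.1 j (by omega) (by omega)]
        exact ha.up i j (by omega) (by omega)
      have h2 := ha.up i (j + 1) (by omega) (by omega)
      by_cases c : j + 1 < d (i + 1)
      · rw [ih.1 (j + 1) (by omega) c] at h0
        split_ifs at h0 <;> omega
      · have c' : j + 1 = d (i + 1) := by omega
        have hl := hlt (i + 1) hi
        have hs := hd.step i hi
        rw [← c'] at hl hs
        split_ifs at h0 <;> omega
  exact fun i j hij hj => (main i (by omega)).2 j hij hj

end IsSlidePath

/-! ### Path removals as slides -/

namespace EdgeLabelling

/-- The part of the definition of an LR `r`-hive that path removals need and preserve. -/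
structure IsWeakHive (r : ℕ) (H : EdgeLabelling) : Prop where
  gt : IsGTPattern r H.α
  alpha_zero_nonneg : 0 < r → 0 ≤ H.α 0 r
  beta_nonneg : ∀ i, 1 ≤ i → i ≤ r → 0 ≤ H.β i r
  gamma_diag : ∀ i, i < r → H.α i (i + 1) + H.β (i + 1) (i + 1) = H.γ (i + 1) (i + 1)
  rhombus : ∀ i j, i < j → j < r →
    H.β (i + 1) j + H.α (i + 1) (j + 1) = H.α i (j + 1) + H.β (i + 1) (j + 1)

theorem U_succ (H : EdgeLabelling) (i j : ℕ) : H.U (i + 1) j = H.α (i + 1) j - H.α i j := rfl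

theorem IsLRHive.isWeakHive {n : ℕ} {H : EdgeLabelling} (hH : H.IsLRHive n) : H.IsWeakHive n where
  gt :=
    { up := fun i j hij hj => by
        have := hH.U_nonneg (i + 1) j (by omega) hij hj
        rw [U_succ] at this
        omega
      right := fun i j hij hj => by
        have := hH.R_nonneg (i + 1) (j + 1) (by omega) (by omega) hj
        simp only [R, Nat.add_sub_cancel] at this
        omega }
  alpha_zero_nonneg := fun h => hH.alpha_nonneg 0 n h le_rfl
  beta_nonneg := fun i hi hin => hH.beta_nonneg i n hi hin le_rfl
  gamma_diag := fun i hi => hH.triangle_up (i + 1) (i + 1) (by omega) le_rfl hi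
  rhombus := fun i j hij hj => by
    have h1 := hH.triangle_up (i + 1) (j + 1) (by omega) (by omega) hj
    have h2 := hH.triangle_down (i + 1) (j + 1) (by omega) (by omega) hj
    simp only [Nat.add_sub_cancel] at h1 h2
    omega

theorem pathDiag_last (r : ℕ) (H : EdgeLabelling) (i : ℕ) (hi : i + 1 = r) :
    pathDiag r H i = r := by
  rw [pathDiag, show r - 1 - i = 0 by omega, pathDiagAfter]

theorem pathDiag_succ (r : ℕ) (H : EdgeLabelling) (i : ℕ) (hi : i + 1 < r) :
    pathDiag r H i = if 0 < H.U (i + 1) (pathDiag r H (i + 1)) then pathDiag r H (i + 1) - 1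
      else pathDiag r H (i + 1) := by
  rw [pathDiag, show r - 1 - i = (r - 1 - (i + 1)) + 1 by omega, pathDiagAfter,
    show r - 1 - (r - 1 - (i + 1)) = i + 1 by omega]
  rfl

namespace IsWeakHive

variable {r : ℕ} {H : EdgeLabelling}

theorem isSlidePath (hH : H.IsWeakHive r) : IsSlidePath r H.α (pathDiag r H) := by
  have hb : ∀ i, i < r → i < pathDiag r H i ∧ pathDiag r H i ≤ r := by
    refine downward_induction (fun i hi => ?_) fun i hi ih => ?_
    · rw [pathDiag_last r H i hi]; omega
    · rw [pathDiag_succ r H i hi]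
      split_ifs <;> omega
  refine ⟨pathDiag_last r H, fun i hi => ?_⟩
  have h1 := pathDiag_succ r H i hi
  have h2 := hb (i + 1) hi
  have h3 := hH.gt.up i (pathDiag r H (i + 1)) h2.1 h2.2
  rw [U_succ] at h1
  split_ifs at h1 with c
  · right; omega
  · left; omega

theorem alpha_eq_alpha_zero (hH : H.IsWeakHive r) (h : ∀ i, i + 1 < r → H.U (i + 1) r ≤ 0) :
    ∀ i, i < r → pathDiag r H i = r ∧ H.α i r = H.α 0 r := by
  refine fun i hi => hH.isSlidePath.eq_of_eq_zero ?_ i hi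
  have : ∀ i, i < r → pathDiag r H i = r := by
    refine downward_induction (fun i hi => pathDiag_last r H i hi) fun i hi ih => ?_
    rw [pathDiag_succ r H i hi, ih, if_neg (by have := h i hi; omega)]
  exact this 0 (by omega)

/-- A path removal of type (iii) decreases the labels along the straight path. -/
theorem omega_eq_phi (hH : H.IsWeakHive r) (hr : 0 < r) (h : ∀ i, i + 1 < r → H.U (i + 1) r ≤ 0) :
    omega r H = phi r H := by
  have hp := hH.alpha_eq_alpha_zero h
  have hU : ∀ i, 1 ≤ i → i < r → H.U i (pathDiag r H i) ≤ 0 := by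
    intro i hi hir
    obtain ⟨i, rfl⟩ : ∃ k, i = k + 1 := ⟨i - 1, by omega⟩
    rw [(hp (i + 1) hir).1]
    exact h i hir
  unfold omega phi
  ext i j
  · by_cases hi : i < r
    · simp only [(hp i hi).1]
    · simp only [hi, false_and]
  · refine (if_neg ?_).symm
    rintro ⟨h1, h2, h3, -⟩
    have := hU i h1 h2
    omega
  · refine if_congr ?_ rfl rfl
    constructor
    · rintro ⟨h1, h2, h3⟩
      rcases h2.eq_or_lt with h2 | h2
      · exact Or.inl ⟨h2, h3⟩
      · refine Or.inr ⟨h1, h2, ?_, by rw [(hp i h2).1, h3]⟩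
        have := hU i h1 h2
        omega
    · rintro (⟨h1, h2⟩ | ⟨h1, h2, -, h3⟩)
      · exact ⟨by omega, h1.le, h2⟩
      · exact ⟨h1, h2.le, by rw [h3, (hp i h2).1]⟩

theorem lam_eq (hH : H.IsWeakHive (r + 1)) :
    H.lam (r + 1) = H.α r (r + 1) + H.nu (r + 1) (r + 1) :=
  (hH.gamma_diag r (Nat.lt_succ_self r)).symm

theorem alpha_zero_le (hH : H.IsWeakHive r) : ∀ i, i < r → H.α 0 r ≤ H.α i r := by
  intro i
  induction i with
  | zero => exact fun _ => le_rfl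
  | succ i ih => exact fun hi => (ih (by omega)).trans (hH.gt.up i r hi le_rfl)

theorem alpha_nonneg_right (hH : H.IsWeakHive r) (i : ℕ) (hi : i < r) : 0 ≤ H.α i r :=
  (hH.alpha_zero_nonneg (by omega)).trans (hH.alpha_zero_le i hi)

/-- Types (ii) and (iii) are treated as one slide. A path ending at `k ≤ r` has left the last
diagonal, so it is of type (ii) and counted by `V`. -/
theorem removePath_eq_phi (hH : H.IsWeakHive (r + 1)) (hl : 0 < H.lam (r + 1))
    (h : ¬0 < H.nu (r + 1) (r + 1)) :
    removePath (r + 1) H = phi (r + 1) H ∧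
      ∀ k, k ≤ r → pathDiag (r + 1) H 0 = k → IsTypeTwo (r + 1) H := by
  by_cases ht : IsTypeTwo (r + 1) H
  · exact ⟨by rw [removePath, if_neg h, if_pos ht], fun _ _ _ => ht⟩
  · have hU : ∀ i, i + 1 < r + 1 → H.U (i + 1) (r + 1) ≤ 0 := by
      intro i hi
      by_contra hc
      exact ht ⟨h, i + 1, Finset.mem_Ico.2 ⟨by omega, hi⟩, by omega⟩
    have hp := hH.alpha_eq_alpha_zero hU
    have hmu : 0 < H.mu (r + 1) := by
      have h1 := (hp r (by omega)).2
      have h2 := hH.lam_eq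
      simp only [mu]
      omega
    refine ⟨?_, fun k hk hk' => ?_⟩
    · rw [removePath, if_neg h, if_neg ht, if_pos hmu, hH.omega_eq_phi (by omega) hU]
    · have := (hp 0 (by omega)).1
      omega

theorem chi_isWeakHive (hH : H.IsWeakHive (r + 1)) (h : 0 < H.nu (r + 1) (r + 1)) :
    (chi (r + 1) H).IsWeakHive (r + 1) where
  gt := hH.gt
  alpha_zero_nonneg := hH.alpha_zero_nonneg
  beta_nonneg := fun i hi hir => by
    have := hH.beta_nonneg i hi hir
    simp only [nu] at h
    simp only [chi]
    split_ifs with c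
    · rw [c.1] at this ⊢; omega
    · exact this
  gamma_diag := fun i hi => by
    have := hH.gamma_diag i hi
    simp only [chi]
    split_ifs <;> omega
  rhombus := fun i j hij hj => by
    have := hH.rhombus i j hij hj
    simp only [chi]
    rw [if_neg (by omega), if_neg (by omega)]
    exact this

theorem phi_isWeakHive (hH : H.IsWeakHive (r + 1)) (hl : 0 < H.lam (r + 1))
    (h : ¬0 < H.nu (r + 1) (r + 1)) : (phi (r + 1) H).IsWeakHive (r + 1) where
  gt := hH.isSlidePath.isGTPattern_slide hH.gt
  alpha_zero_nonneg := fun _ => by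
    have h1 := hH.alpha_zero_nonneg (by omega)
    simp only [phi]
    split_ifs with c
    -- A path ending in the last diagonal is straight, with all its `α`-labels equal to `λ - ν`,
    -- which is positive here.
    · have h2 := (hH.isSlidePath.eq_of_eq_zero c.2.symm r (by omega)).2
      have h3 := hH.lam_eq
      omega
    · exact h1
  beta_nonneg := fun i hi hir => by
    have := hH.beta_nonneg i hi hir
    simp only [phi]
    split_ifs <;> omega
  gamma_diag := fun i hi => by
    have h1 := hH.gamma_diag i hi
    have h0 := hH.isSlidePath.lt_and_le i hi
    simp only [phi]
    by_cases c : i + 1 = r + 1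
    · have := hH.isSlidePath.start i c
      split_ifs <;> omega
    · have h2 := hH.isSlidePath.lt_and_le (i + 1) (by omega)
      have h3 := pathDiag_succ (r + 1) H i (by omega)
      split_ifs at h3 ⊢ <;> omega
  rhombus := fun i j hij hj => by
    have h1 := hH.rhombus i j hij hj
    have h2 := hH.isSlidePath.lt_and_le (i + 1) (by omega)
    have h3 := pathDiag_succ (r + 1) H i (by omega)
    simp only [phi]
    split_ifs at h3 ⊢ <;> omega

/-- The effect of one path removal. -/
theorem removePath_spec (hH : H.IsWeakHive (r + 1)) (hl : 0 < H.lam (r + 1)) :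
    (removePath (r + 1) H).IsWeakHive (r + 1) ∧
    (removePath (r + 1) H).lam (r + 1) = H.lam (r + 1) - 1 ∧
    (∀ a, IsPromotion (r + 1) (removePath (r + 1) H).α a → IsPromotion (r + 1) H.α a) ∧
    (∀ i, i ≤ r → (removePath (r + 1) H).β i (r + 1) = H.β i (r + 1)) ∧
    (∀ i, i ≤ r → (removePath (r + 1) H).γ i i = H.γ i i) ∧
    (∀ k, k ≤ r → (removePath (r + 1) H).α 0 k = H.α 0 k -
      if IsTypeTwo (r + 1) H ∧ pathDiag (r + 1) H 0 = k then 1 else 0) := by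
  by_cases h : 0 < H.nu (r + 1) (r + 1)
  · rw [show removePath (r + 1) H = chi (r + 1) H from if_pos h]
    refine ⟨hH.chi_isWeakHive h, by simp [chi, lam], fun _ => id, fun i hi => ?_, fun i hi => ?_,
      fun k hk => ?_⟩
    · exact if_neg (by omega)
    · exact if_neg (by omega)
    · rw [if_neg (fun c => c.1.1 h), sub_zero]
      rfl
  · obtain ⟨e, ht⟩ := hH.removePath_eq_phi hl h
    rw [e]
    refine ⟨hH.phi_isWeakHive hl h, by simp [phi, lam],
      fun a ha => hH.isSlidePath.isPromotion_of_slide hH.gt ha, fun i hi => ?_, fun i hi => ?_,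
      fun k hk => ?_⟩
    · refine if_neg ?_
      rintro ⟨h1, h2, -, h3⟩
      have := hH.isSlidePath.lt_and_le i h2
      omega
    · refine if_neg ?_
      rintro (⟨h1, -⟩ | ⟨h1, h2, -, h3⟩)
      · omega
      · have := hH.isSlidePath.lt_and_le i h2
        omega
    · simp only [phi]
      by_cases c : pathDiag (r + 1) H 0 = k
      · rw [if_pos ⟨by omega, c.symm⟩, if_pos ⟨ht k hk c, c⟩]
      · rw [if_neg (fun c' => c c'.2.symm), if_neg (fun c' => c c'.2), sub_zero]

/-- The effect of the full path removal operator. -/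
theorem theta_spec (hH : H.IsWeakHive (r + 1)) :
    (theta (r + 1) H).IsWeakHive (r + 1) ∧
    (theta (r + 1) H).lam (r + 1) = 0 ∧
    (∀ a, IsPromotion (r + 1) (theta (r + 1) H).α a → IsPromotion (r + 1) H.α a) ∧
    (∀ i, i ≤ r → (theta (r + 1) H).β i (r + 1) = H.β i (r + 1)) ∧
    (∀ i, i ≤ r → (theta (r + 1) H).γ i i = H.γ i i) ∧
    (∀ k, k ≤ r → (theta (r + 1) H).α 0 k = H.α 0 k - V (r + 1) H k) := by
  have hl : 0 ≤ H.lam (r + 1) := by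
    rw [hH.lam_eq]
    exact add_nonneg (hH.alpha_nonneg_right r (by omega)) (hH.beta_nonneg _ (by omega) le_rfl)
  unfold theta V
  generalize hm : (H.lam (r + 1)).toNat = m
  induction m generalizing H with
  | zero =>
    refine ⟨hH, by simp only [Function.iterate_zero, id]; omega, fun _ => id, fun _ _ => rfl,
      fun _ _ => rfl, fun k _ => ?_⟩
    simp
  | succ m ih =>
    obtain ⟨h1, h2, h3, h4, h5, h6⟩ := hH.removePath_spec (by omega)
    obtain ⟨k1, k2, k3, k4, k5, k6⟩ := ih h1 (by omega) (by omega)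
    simp only [Function.iterate_succ_apply]
    refine ⟨k1, k2, fun a ha => h3 a (k3 a ha), fun i hi => (k4 i hi).trans (h4 i hi),
      fun i hi => (k5 i hi).trans (h5 i hi), fun k hk => ?_⟩
    rw [k6 k hk, h6 k hk, Finset.natCast_card_filter, Finset.natCast_card_filter,
      Finset.sum_range_succ']
    simp only [Function.iterate_succ_apply, Function.iterate_zero, id]
    rw [sub_sub, add_comm]
    congr!

/-- The passage from an `(r + 1)`-hive to an `r`-hive in the construction of `σ`. -/
theorem kappa_theta_spec (hH : H.IsWeakHive (r + 1)) :
    (kappa (r + 1) (theta (r + 1) H)).IsWeakHive r ∧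
    IsPromotion (r + 1) H.α (kappa (r + 1) (theta (r + 1) H)).α ∧
    (∀ i, 1 ≤ i → i ≤ r → (kappa (r + 1) (theta (r + 1) H)).β i r = H.β i (r + 1)) ∧
    (∀ i, i ≤ r → (kappa (r + 1) (theta (r + 1) H)).γ i i = H.γ i i) ∧
    (∀ k, k ≤ r → (kappa (r + 1) (theta (r + 1) H)).α 0 k = H.α 0 k - V (r + 1) H k) := by
  obtain ⟨h1, h2, h3, h4, h5, h6⟩ := hH.theta_spec
  set T := theta (r + 1) H
  -- With `λ = 0` the bottom label of the last diagonal vanishes; the labels above it are smaller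
  -- but non-negative.
  have hzero : ∀ i, i < r + 1 → T.α i (r + 1) = 0 := by
    have hlast : T.α r (r + 1) = 0 := by
      have := h1.lam_eq
      have := h1.alpha_nonneg_right r (by omega)
      have := h1.beta_nonneg (r + 1) (by omega) le_rfl
      simp only [nu] at *
      omega
    refine downward_induction (fun i hi => ?_) fun i hi ih => ?_
    · rw [show i = r by omega, hlast]
    · have := h1.gt.up i (r + 1) hi le_rfl
      have := h1.alpha_nonneg_right i (by omega)
      omega
  have hprom : IsPromotion (r + 1) T.α (kappa (r + 1) T).α :=
    (h1.gt.isPromotion_self hzero).congr fun i j hj => if_pos hj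
  have hbeta : ∀ i, 1 ≤ i → i ≤ r → (kappa (r + 1) T).β i r = H.β i (r + 1) := by
    intro i hi hir
    obtain ⟨i, rfl⟩ : ∃ k, i = k + 1 := ⟨i - 1, by omega⟩
    have := h1.rhombus i r (by omega) (by omega)
    rw [hzero i (by omega), hzero (i + 1) (by omega), h4 (i + 1) hir] at this
    rw [show (kappa (r + 1) T).β (i + 1) r = T.β (i + 1) r from if_pos (by omega)]
    omega
  refine ⟨⟨h1.gt.promotion hprom, fun hr => ?_, fun i hi hir => ?_, fun i hi => ?_,
    fun i j hij hj => ?_⟩, h3 _ hprom, hbeta, fun i hi => ?_, fun k hk => ?_⟩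
  · have := h1.gt.right 0 r hr (by omega)
    rw [hzero (0 + 1) (by omega)] at this
    exact this.trans_eq (if_pos (by omega)).symm
  · rw [hbeta i hi hir]
    exact hH.beta_nonneg i hi (by omega)
  · have := h1.gamma_diag i (by omega)
    simp only [kappa]
    rw [if_pos (by omega), if_pos (by omega), if_pos (by omega), this]
  · have := h1.rhombus i j hij (by omega)
    simp only [kappa]
    rw [if_pos (by omega), if_pos (by omega), if_pos (by omega), if_pos (by omega), this]
  · rw [← h5 i hi]
    exact if_pos (by omega)
  · rw [← h6 k hk]
    exact if_pos (by omega)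

end IsWeakHive

end EdgeLabelling

/-! ### The map `σ` as a record of successive promotions -/

open Finset

namespace EdgeLabelling

/-- The rhombus conditions telescope along the strip between the rows `i` and `i + 1`. -/
theorem IsWeakHive.sum_alpha_succ {r : ℕ} {H : EdgeLabelling} (hH : H.IsWeakHive r) (i : ℕ)
    {t : ℕ} (hit : i < t) (ht : t ≤ r) :
    ∑ m ∈ Ioc i t, H.α i m =
      H.γ (i + 1) (i + 1) - H.β (i + 1) t + ∑ m ∈ Ioc (i + 1) t, H.α (i + 1) m := by
  induction t, hit using Nat.le_induction with
  | base =>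
    have := hH.gamma_diag i ht
    simp only [Nat.succ_eq_add_one, Nat.Ioc_succ_singleton, sum_singleton, Ioc_self, sum_empty]
    omega
  | succ t hit ih =>
    have := hH.rhombus i t hit ht
    rw [sum_Ioc_succ_top (by omega), sum_Ioc_succ_top (by omega), ih (by omega)]
    omega

/-- This is the wall `j = r` of the octahedron array. The subtracted terms `λ_m - ν_m` survive every
`κ_r θ_r`, so one sequence serves all levels. -/
theorem IsWeakHive.sum_alpha_eq {r : ℕ} {H : EdgeLabelling} (hH : H.IsWeakHive r) (i : ℕ)
    (hi : i ≤ r) : ∑ m ∈ Ioc i r, (H.α i m - (H.γ m m - H.β m r)) = 0 := by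
  induction hi using Nat.decreasingInduction with
  | self => simp
  | of_succ i hi ih =>
    have h1 := hH.sum_alpha_succ i hi le_rfl
    rw [sum_sub_distrib] at ih ⊢
    rw [h1, ← sum_Ioc_consecutive _ (Nat.le_succ i) hi, Nat.Ioc_succ_singleton, sum_singleton]
    linear_combination ih

/-- The labelling `K` arises from `K₀` by adding the diagonals that record the successive
promotions `a r, a (r - 1), …` of the pattern formed by the `α`-labels of the `r`-hive `H`. -/
structure IsEvacuation (r : ℕ) (H K₀ K : EdgeLabelling) (a : ℕ → ℕ → ℕ → ℤ) : Prop where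
  top : a r = H.α
  gt : ∀ s, s ≤ r → IsGTPattern s (a s)
  nonneg : ∀ s, 0 < s → s ≤ r → 0 ≤ a s 0 s
  promotion : ∀ s, s < r → IsPromotion (s + 1) (a (s + 1)) (a s)
  sum_eq_zero : ∀ s i, i ≤ s → s ≤ r → ∑ m ∈ Ioc i s, (a s i m - (H.γ m m - H.β m r)) = 0
  alpha : ∀ i s, K.α i s = if i < s ∧ s ≤ r then
    H.β s r + ∑ k ∈ Icc 1 i, (a s 0 k - a (s - 1) 0 k) else K₀.α i s
  beta : ∀ i s, K.β i s = if 1 ≤ i ∧ i ≤ s ∧ s < r then a s 0 i else K₀.β i s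
  gamma : ∀ i s, K.γ i s = if i = s ∧ 1 ≤ s ∧ s ≤ r then H.γ s s
    else if 1 ≤ i ∧ i < s ∧ s ≤ r then
      H.β s r + ∑ k ∈ Icc 1 (i - 1), (a s 0 k - a (s - 1) 0 k) + a s 0 i
    else K₀.γ i s

theorem IsWeakHive.exists_isEvacuation {r : ℕ} {H K : EdgeLabelling} (hH : H.IsWeakHive r)
    (hK : ∀ i, 1 ≤ i → i ≤ r → K.β i r = H.α 0 i) :
    ∃ a, IsEvacuation r H K (ThetaAll r (H, K)).2 a := by
  induction r generalizing H K with
  | zero =>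
    refine ⟨fun _ => H.α, rfl, fun s hs => ?_, fun s _ _ => by omega, fun s _ => by omega,
      fun s i _ _ => ?_, fun i s => ?_, fun i s => ?_, fun i s => ?_⟩
    · obtain rfl : s = 0 := by omega
      exact hH.gt
    · obtain rfl : s = 0 := by omega
      simp
    · rw [if_neg (by omega)]; rfl
    · rw [if_neg (by omega)]; rfl
    · rw [if_neg (by omega), if_neg (by omega)]; rfl
  | succ r ih =>
    obtain ⟨h1, h2, h3, h4, h5⟩ := hH.kappa_theta_spec
    set H₁ := kappa (r + 1) (theta (r + 1) H) with hH₁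
    set K₁ := addDiagonal (r + 1) (H.nu (r + 1) (r + 1)) (H.lam (r + 1))
      (fun k => (V (r + 1) H k : ℤ)) K with hK₁
    have hT : ThetaAll (r + 1) (H, K) = ThetaAll r (H₁, K₁) := rfl
    obtain ⟨a, ha⟩ := ih h1 (K := K₁) (fun i hi hir => by
      simp only [hK₁, addDiagonal]
      rw [if_pos ⟨hi, by omega, trivial⟩, hK i hi (by omega), h5 i hir])
    have hlt : ∀ s, s ≤ r → Function.update a (r + 1) H.α s = a s := fun s hs =>
      Function.update_of_ne (by omega) _ _
    have htop : Function.update a (r + 1) H.α (r + 1) = H.α := Function.update_self _ _ _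
    have hV : ∀ k, k ≤ r → H.α 0 k - a r 0 k = V (r + 1) H k := by
      intro k hk
      rw [ha.top, h5 k hk]
      ring
    rw [hT]
    refine ⟨Function.update a (r + 1) H.α, htop, fun s hs => ?_, fun s h0 hs => ?_,
      fun s hs => ?_, fun s i his hs => ?_, fun i s => ?_, fun i s => ?_, fun i s => ?_⟩
    · rcases hs.eq_or_lt with rfl | hs
      · rw [htop]; exact hH.gt
      · rw [hlt s (by omega)]; exact ha.gt s (by omega)
    · rcases hs.eq_or_lt with rfl | hs
      · rw [htop]; exact hH.alpha_zero_nonneg h0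
      · rw [hlt s (by omega)]; exact ha.nonneg s h0 (by omega)
    · rw [hlt s (by omega)]
      rcases (Nat.lt_succ_iff.1 hs).eq_or_lt with rfl | hs
      · rw [htop, ha.top]; exact h2
      · rw [hlt (s + 1) (by omega)]; exact ha.promotion s hs
    · rcases hs.eq_or_lt with rfl | hs
      · rw [htop]; exact hH.sum_alpha_eq i his
      · rw [hlt s (by omega), ← ha.sum_eq_zero s i his (by omega)]
        refine sum_congr rfl fun m hm => ?_
        rw [mem_Ioc] at hm
        rw [h3 m (by omega) (by omega), h4 m (by omega)]
    · rw [ha.alpha]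
      by_cases c : i < s ∧ s ≤ r
      · rw [if_pos c, if_pos (by omega), h3 s (by omega) c.2, hlt s c.2, hlt (s - 1) (by omega)]
      · rw [if_neg c]
        simp only [hK₁, addDiagonal]
        by_cases c' : i < r + 1 ∧ s = r + 1
        · obtain ⟨c1, rfl⟩ := c'
          rw [if_pos ⟨c1, rfl⟩, if_pos (by omega), htop, Nat.add_sub_cancel, hlt r le_rfl]
          refine congrArg _ (sum_congr rfl fun k hk => ?_)
          rw [mem_Icc] at hk
          exact (hV k (by omega)).symm
        · rw [if_neg c', if_neg (by omega)]
    · rw [ha.beta]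
      by_cases c : 1 ≤ i ∧ i ≤ s ∧ s < r
      · rw [if_pos c, if_pos (by omega), hlt s (by omega)]
      · rw [if_neg c]
        simp only [hK₁, addDiagonal]
        by_cases c' : 1 ≤ i ∧ i < r + 1 ∧ s + 1 = r + 1
        · obtain rfl : s = r := by omega
          rw [if_pos c', if_pos (by omega), hlt s le_rfl, hK i c'.1 (by omega), ha.top,
            h5 i (by omega)]
        · rw [if_neg c', if_neg (by omega)]
    · rw [ha.gamma]
      by_cases c : i = s ∧ 1 ≤ s ∧ s ≤ r
      · rw [if_pos c, if_pos (by omega), h4 s c.2.2]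
      rw [if_neg c]
      by_cases c2 : 1 ≤ i ∧ i < s ∧ s ≤ r
      · rw [if_pos c2, if_neg (by omega), if_pos (by omega), h3 s (by omega) c2.2.2,
          hlt s c2.2.2, hlt (s - 1) (by omega)]
      rw [if_neg c2]
      simp only [hK₁, addDiagonal]
      by_cases c3 : i = r + 1 ∧ s = r + 1
      · rw [if_pos c3, if_pos (show i = s ∧ 1 ≤ s ∧ s ≤ r + 1 by omega), c3.2]
        rfl
      rw [if_neg c3, if_neg (show ¬(i = s ∧ 1 ≤ s ∧ s ≤ r + 1) by omega)]
      by_cases c4 : 1 ≤ i ∧ i < r + 1 ∧ s = r + 1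
      · obtain ⟨d1, d2, rfl⟩ := c4
        rw [if_pos ⟨d1, d2, rfl⟩, if_pos (show 1 ≤ i ∧ i < r + 1 ∧ r + 1 ≤ r + 1 by omega), htop,
          Nat.add_sub_cancel, hlt r le_rfl, hK i d1 (by omega)]
        refine congrArg (· + H.α 0 i) (congrArg _ (sum_congr rfl fun k hk => ?_))
        rw [mem_Icc] at hk
        exact (hV k (by omega)).symm
      · rw [if_neg c4, if_neg (show ¬(1 ≤ i ∧ i < s ∧ s ≤ r + 1) by omega)]

end EdgeLabelling

/-! ### Promotion and the octahedron recurrence -/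

/-- The potential of a sequence of successive promotions solves the octahedron recurrence. -/
theorem isOctahedronArray_of_promotion {n : ℕ} {a : ℕ → ℕ → ℕ → ℤ} {c : ℕ → ℤ}
    (hp : ∀ s, s < n → IsPromotion (s + 1) (a (s + 1)) (a s))
    (hs : ∀ s i, i ≤ s → s ≤ n → ∑ m ∈ Ioc i s, (a s i m - c m) = 0) :
    IsOctahedronArray n fun i j r => ∑ m ∈ Ioc i j, (a r i m - c m) where
  wall_left := fun i r _ _ => by simp
  wall_right := fun i r hi hr => hs r i hi hr
  octahedron := fun i j r hij hj hr => by
    induction j, hij using Nat.le_induction with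
    | base =>
      have := hp r hr i (i + 1) (by omega) (by omega)
      rw [if_pos rfl, if_neg (by omega)] at this
      simp only [Nat.succ_eq_add_one, Ioc_self, sum_empty, add_zero,
        sum_Ioc_succ_top (show i ≤ i + 1 by omega), sum_Ioc_succ_top (le_refl i),
        sum_Ioc_succ_top (le_refl (i + 1)), zero_add]
      omega
    | succ j hij ih =>
      have h0 := ih (by omega)
      have := hp r hr i (j + 1) (by omega) (by omega)
      rw [if_neg (by omega), if_neg (by omega)] at this
      simp only [sum_Ioc_succ_top (show i ≤ j by omega), sum_Ioc_succ_top (show i ≤ j + 1 by omega),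
        sum_Ioc_succ_top (show i + 1 ≤ j by omega),
        sum_Ioc_succ_top (show i + 1 ≤ j + 1 by omega)] at h0 ⊢
      omega

namespace IsOctahedronArray

variable {n : ℕ} {G : ℕ → ℕ → ℕ → ℤ}

/-- The recurrence for promotion is the difference of two adjacent octahedron relations; subtracting
a `max` produces the `min`. At the walls the relation degenerates, which accounts for the
exceptional cases. -/
theorem isPromotion (hG : IsOctahedronArray n G) (c : ℕ → ℤ) (s : ℕ) (hs : s < n) :
    IsPromotion (s + 1) (fun i j => G i j (s + 1) - G i (j - 1) (s + 1) + c j)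
      (fun i j => G i j s - G i (j - 1) s + c j) := by
  intro i j hij hj
  obtain ⟨j, rfl⟩ : ∃ k, j = k + 1 := ⟨j - 1, by omega⟩
  simp only [Nat.add_sub_cancel]
  have h1 : i = j ∧ G i j s + G (i + 1) (j + 1) (s + 1) = G i j (s + 1) + G (i + 1) (j + 1) s ∨
      i < j ∧ G i j s + G (i + 1) (j + 1) (s + 1) =
        max (G i j (s + 1) + G (i + 1) (j + 1) s) (G i (j + 1) (s + 1) + G (i + 1) j s) := by
    rcases (Nat.lt_succ_iff.1 hij).eq_or_lt with rfl | h
    · left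
      rw [hG.wall_left _ _ (by omega) (by omega), hG.wall_left _ _ (by omega) (by omega),
        hG.wall_left _ _ (by omega) (by omega), hG.wall_left _ _ (by omega) (by omega)]
      exact ⟨rfl, rfl⟩
    · right
      exact ⟨h, hG.octahedron i j s h (by omega) hs⟩
  have h2 : j + 1 = s ∧ G i (j + 1) s + G (i + 1) (j + 2) (s + 1) =
        G i (j + 2) (s + 1) + G (i + 1) (j + 1) s ∨
      j + 1 < s ∧ G i (j + 1) s + G (i + 1) (j + 2) (s + 1) =
        max (G i (j + 1) (s + 1) + G (i + 1) (j + 2) s)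
          (G i (j + 2) (s + 1) + G (i + 1) (j + 1) s) := by
    rcases (Nat.lt_succ_iff.1 hj).eq_or_lt with rfl | h
    · left
      rw [hG.wall_right _ _ (by omega) (by omega), hG.wall_right _ _ (by omega) (by omega),
        hG.wall_right _ _ (by omega) (by omega), hG.wall_right _ _ (by omega) (by omega)]
      exact ⟨rfl, rfl⟩
    · right
      exact ⟨h, hG.octahedron i (j + 1) s hij h hs⟩
  simp only [show j + 1 + 1 = j + 2 from rfl]
  split_ifs <;> omega

end IsOctahedronArray

/-- If the rows `0` of successive patterns interlace, then so do the rows of each pattern. -/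
theorem isGTPattern_of_interlace {n : ℕ} {a : ℕ → ℕ → ℕ → ℤ}
    (hp : ∀ s, s < n → IsPromotion (s + 1) (a (s + 1)) (a s))
    (h0 : ∀ s, s < n → ∀ j, 0 < j → j ≤ s → a s 0 j ≤ a (s + 1) 0 j ∧
      a (s + 1) 0 (j + 1) ≤ a s 0 j) : IsGTPattern n (a n) := by
  -- Interlacing of row `i` between levels gives interlacing of the rows `i` and `i + 1` within each
  -- level, by induction on the level.
  have row : ∀ i, (∀ s, s < n → ∀ j, i < j → j ≤ s → a s i j ≤ a (s + 1) i j ∧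
      a (s + 1) i (j + 1) ≤ a s i j) →
      (∀ s, s ≤ n → ∀ j, i < j → j < s → a s i (j + 1) ≤ a s (i + 1) (j + 1) ∧
        a s (i + 1) (j + 1) ≤ a s i j) := by
    intro i hX s
    induction s with
    | zero => intro _ j _ h; omega
    | succ s ih =>
      intro hs j hij hj
      have e := hp s hs i j hij hj
      have x := hX s hs j hij (by omega)
      have y1 : j ≠ i + 1 → a s i j ≤ a s (i + 1) j := by
        intro hne
        obtain ⟨j, rfl⟩ : ∃ k, j = k + 1 := ⟨j - 1, by omega⟩
        exact (ih (by omega) j (by omega) (by omega)).1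
      have y2 : j + 1 ≠ s + 1 → a s (i + 1) (j + 1) ≤ a s i j := fun hne =>
        (ih (by omega) j hij (by omega)).2
      split_ifs at e with c1 c2 c2
      · omega
      · specialize y2 c2; omega
      · specialize y1 c1; omega
      · specialize y1 c1; specialize y2 c2; omega
  -- Interlacing between levels then passes from row `i` to row `i + 1`.
  have main : ∀ i s, s < n → ∀ j, i < j → j ≤ s → a s i j ≤ a (s + 1) i j ∧
      a (s + 1) i (j + 1) ≤ a s i j := by
    intro i
    induction i with
    | zero => exact h0
    | succ i ih =>
      intro s hs j hij hj
      have e1 := hp s hs i j (by omega) (by omega)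
      obtain ⟨j, rfl⟩ : ∃ k, j = k + 1 := ⟨j - 1, by omega⟩
      have e2 := hp s hs i j (by omega) (by omega)
      have r1 := row i ih s (by omega) j (by omega) (by omega)
      have x1 := ih s hs (j + 1) (by omega) hj
      have x2 := ih s hs j (by omega) (by omega)
      have y1 : j ≠ i + 1 → a s i j ≤ a s (i + 1) j := by
        intro hne
        obtain ⟨j, rfl⟩ : ∃ k, j = k + 1 := ⟨j - 1, by omega⟩
        exact (row i ih s (by omega) j (by omega) (by omega)).1
      have y2 : j + 1 ≠ s → a s (i + 1) (j + 2) ≤ a s i (j + 1) := fun hne =>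
        (row i ih s (by omega) (j + 1) (by omega) (by omega)).2
      rw [if_neg (by omega)] at e1
      rw [if_neg (show j + 1 ≠ s + 1 by omega)] at e2
      simp only [show j + 1 + 1 = j + 2 from rfl] at *
      constructor
      · split_ifs at e2 with c
        · omega
        · specialize y1 c; omega
      · split_ifs at e1 with c
        · omega
        · specialize y2 (by omega); omega
  constructor
  · intro i j hij hj
    obtain ⟨j, rfl⟩ : ∃ k, j = k + 1 := ⟨j - 1, by omega⟩
    exact (row i (main i) n le_rfl j (by omega) hj).1
  · intro i j hij hj
    exact (row i (main i) n le_rfl j hij hj).2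

/-! ### The image is a hive, and `σ` is an involution -/

namespace EdgeLabelling

variable {n : ℕ} {H K : EdgeLabelling} {a : ℕ → ℕ → ℕ → ℤ}

theorem IsLRHive.exists_isEvacuation_sigma (hH : H.IsLRHive n) :
    ∃ a, IsEvacuation n H (emptyTruncated n H) (sigma n H) a :=
  hH.isWeakHive.exists_isEvacuation fun _ hi hin => if_pos ⟨hi, hin, rfl⟩

namespace IsEvacuation

theorem alpha_eq (hE : IsEvacuation n H (emptyTruncated n H) K a) {i s : ℕ} (h : i < s)
    (hs : s ≤ n) : K.α i s = H.β s n + ∑ k ∈ Icc 1 i, (a s 0 k - a (s - 1) 0 k) := by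
  rw [hE.alpha, if_pos ⟨h, hs⟩]

theorem beta_eq (hE : IsEvacuation n H (emptyTruncated n H) K a) {i s : ℕ} (h1 : 1 ≤ i)
    (h : i ≤ s) (hs : s ≤ n) : K.β i s = a s 0 i := by
  rw [hE.beta]
  rcases hs.eq_or_lt with rfl | hs
  · rw [if_neg (by omega), hE.top]
    exact if_pos ⟨h1, h, rfl⟩
  · rw [if_pos ⟨h1, h, hs⟩]

theorem gamma_diag_eq (hE : IsEvacuation n H (emptyTruncated n H) K a) {s : ℕ} (h1 : 1 ≤ s)
    (hs : s ≤ n) : K.γ s s = H.γ s s := by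
  rw [hE.gamma, if_pos ⟨rfl, h1, hs⟩]

theorem sum_zero_eq (hE : IsEvacuation n H (emptyTruncated n H) K a) {s : ℕ} (hs : s ≤ n) :
    ∑ k ∈ Icc 1 s, a s 0 k = ∑ k ∈ Icc 1 s, (H.γ k k - H.β k n) := by
  have h := hE.sum_eq_zero s 0 (Nat.zero_le s) hs
  rw [sum_sub_distrib, sub_eq_zero] at h
  exact h

theorem triangle_up (hE : IsEvacuation n H (emptyTruncated n H) K a) (i s : ℕ) (h1 : 1 ≤ i)
    (h : i ≤ s) (hs : s ≤ n) : K.α (i - 1) s + K.β i s = K.γ i s := by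
  obtain ⟨i, rfl⟩ : ∃ k, i = k + 1 := ⟨i - 1, by omega⟩
  rw [hE.alpha_eq (by omega) hs, hE.beta_eq h1 h hs, Nat.add_sub_cancel]
  rcases h.eq_or_lt with rfl | h
  · rw [hE.gamma_diag_eq h1 hs]
    have e1 := hE.sum_zero_eq hs
    have e2 := hE.sum_zero_eq (s := i) (by omega)
    rw [sum_Icc_succ_top (by omega), sum_Icc_succ_top (by omega)] at e1
    rw [sum_sub_distrib, Nat.add_sub_cancel]
    linear_combination e1 - e2
  · rw [hE.gamma, if_neg (by omega), if_pos ⟨h1, h, hs⟩, Nat.add_sub_cancel]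

theorem interlace (hE : IsEvacuation n H (emptyTruncated n H) K a) {i s : ℕ} (h1 : 1 ≤ i)
    (h : i ≤ s) (hs : s < n) : a s 0 i ≤ a (s + 1) 0 i ∧ a (s + 1) 0 (i + 1) ≤ a s 0 i :=
  (hE.gt (s + 1) hs).promotion_interlace (hE.promotion s hs) 0 (by omega) i (by omega) (by omega)

theorem zero_nonneg (hE : IsEvacuation n H (emptyTruncated n H) K a) {i s : ℕ} (h1 : 1 ≤ i)
    (h : i ≤ s) (hs : s ≤ n) : 0 ≤ a s 0 i := by
  induction h using Nat.decreasingInduction with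
  | self => exact hE.nonneg s (by omega) hs
  | of_succ i hi ih =>
    have h2 := (hE.gt s hs).right 0 i (by omega) hi
    have h3 := (hE.gt s hs).up 0 (i + 1) (by omega) hi
    have := ih (by omega)
    omega

/-- The inequalities for `U` and `L` express the interlacing of the rows `0` under promotion. Only
those for `R` need `hK`, which comes from duality. -/
theorem isLRHive (hH : H.IsLRHive n) (hE : IsEvacuation n H (emptyTruncated n H) K a)
    (hK : IsGTPattern n K.α) : K.IsLRHive n := by
  have hU : ∀ i j, 1 ≤ i → i < j → j ≤ n → K.U i j = a j 0 i - a (j - 1) 0 i := by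
    intro i j hi hij hj
    obtain ⟨i, rfl⟩ : ∃ k, i = k + 1 := ⟨i - 1, by omega⟩
    rw [U_succ, hE.alpha_eq hij hj, hE.alpha_eq (by omega) hj, sum_Icc_succ_top (by omega)]
    ring
  have hU0 : ∀ i j, 1 ≤ i → i < j → j ≤ n → 0 ≤ a j 0 i - a (j - 1) 0 i := by
    intro i j hi hij hj
    obtain ⟨j, rfl⟩ : ∃ k, j = k + 1 := ⟨j - 1, by omega⟩
    have := hE.interlace hi (show i ≤ j by omega) hj
    rw [Nat.add_sub_cancel]
    omega
  have hα : ∀ i j, i < j → j ≤ n → 0 ≤ K.α i j := by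
    intro i j hij hj
    rw [hE.alpha_eq hij hj]
    refine add_nonneg (hH.beta_nonneg j n (by omega) hj le_rfl) (sum_nonneg fun k hk => ?_)
    rw [mem_Icc] at hk
    exact hU0 k j hk.1 (by omega) hj
  have hβ : ∀ i j, 1 ≤ i → i ≤ j → j ≤ n → 0 ≤ K.β i j := by
    intro i j hi hij hj
    rw [hE.beta_eq hi hij hj]
    exact hE.zero_nonneg hi hij hj
  refine ⟨fun i j h => ?_, fun i j h => ?_, fun i j h => ?_, hE.triangle_up,
    fun i j hi hij hj => ?_, fun i j hi hij hj => ?_, fun i j hi hij hj => ?_,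
    fun i j hi hij hj => ?_, hα, hβ, fun i j hi hij hj => ?_⟩
  · rw [hE.alpha, if_neg h]
    rfl
  · rw [hE.beta, if_neg (by omega)]
    refine if_neg ?_
    rintro ⟨h1, h2, rfl⟩
    exact h ⟨h1, h2, le_rfl⟩
  · rw [hE.gamma, if_neg (by omega), if_neg (by omega)]
    rfl
  · have h1 := hE.triangle_up i j hi hij.le hj
    have h2 := hU i j hi hij hj
    rw [hE.beta_eq hi hij.le hj] at h1
    rw [hE.beta_eq hi (by omega) (by omega)]
    simp only [U] at h2
    omega
  · obtain ⟨i, rfl⟩ : ∃ k, i = k + 1 := ⟨i - 1, by omega⟩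
    obtain ⟨j, rfl⟩ : ∃ k, j = k + 1 := ⟨j - 1, by omega⟩
    have := hK.right i j (by omega) (by omega)
    simp only [R, Nat.add_sub_cancel]
    omega
  · rw [hU i j hi hij hj]
    exact hU0 i j hi hij hj
  · obtain ⟨j, rfl⟩ : ∃ k, j = k + 1 := ⟨j - 1, by omega⟩
    have := (hE.interlace hi (show i ≤ j by omega) hj).2
    simp only [L, Nat.add_sub_cancel]
    rw [hE.beta_eq hi (by omega) (by omega), hE.beta_eq (by omega) (by omega) hj]
    omega
  · rw [← hE.triangle_up i j hi hij hj]
    exact add_nonneg (hα _ _ (by omega) hj) (hβ i j hi hij hj)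

/-- The `α`-labels of `K` and the `β`-labels of `H` lie on two faces of a solution of the
octahedron recurrence. -/
theorem exists_dual (hH : H.IsLRHive n) (hE : IsEvacuation n H (emptyTruncated n H) K a) :
    ∃ G, IsOctahedronArray n G ∧
      (∀ i j, i < j → j ≤ n →
        G i j n - G i (j - 1) n + (K.γ j j - K.β j n) = K.α i j) ∧
      (∀ j s, 1 ≤ j → j ≤ s → s ≤ n →
        G 0 j s - G 0 (j - 1) s + (K.γ j j - K.β j n) = H.β j s) := by
  -- The array of `H` is normalized by `λ - ν`, its dual by `λ - μ`, the corresponding sequence of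
  -- `K`; the boundary terms of the duality account for the change.
  obtain ⟨G, hG, h1, h2⟩ := (isOctahedronArray_of_promotion hE.promotion hE.sum_eq_zero).exists_dual
  have hc : ∀ j, 1 ≤ j → j ≤ n → K.γ j j - K.β j n = H.γ j j - H.α 0 j := fun j hj hjn => by
    rw [hE.gamma_diag_eq hj hjn, hE.beta_eq hj hjn le_rfl, hE.top]
  have hsum : ∀ s i, i ≤ s → ∑ m ∈ Ioc 0 i, (a s 0 m - (H.γ m m - H.β m n)) =
      ∑ k ∈ Icc 1 i, a s 0 k - ∑ k ∈ Icc 1 i, (H.γ k k - H.β k n) := fun s i _ => by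
    rw [sum_sub_distrib]
    rfl
  refine ⟨G, hG, fun i j hij hj => ?_, fun j s hj hjs hs => ?_⟩
  · obtain ⟨j, rfl⟩ : ∃ k, j = k + 1 := ⟨j - 1, by omega⟩
    have e1 := hsum (j + 1) i hij.le
    have e2 := hsum j i (by omega)
    rw [Nat.add_sub_cancel, h1 i (j + 1) hij.le hj, h1 i j (by omega) (by omega),
      hc (j + 1) (by omega) hj, hE.alpha_eq hij hj, sum_sub_distrib (s := Icc 1 i),
      Nat.add_sub_cancel, e1, e2, sum_Ioc_succ_top (Nat.zero_le j), hE.top]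
    ring
  · obtain ⟨j, rfl⟩ : ∃ k, j = k + 1 := ⟨j - 1, by omega⟩
    have e1 := hH.isWeakHive.sum_alpha_succ j hjs hs
    have e2 := sum_Ioc_consecutive (fun m => H.γ m m - H.β m n) (Nat.le_succ j) hjs
    rw [Nat.Ioc_succ_singleton, sum_singleton] at e2
    rw [Nat.add_sub_cancel, h2 (j + 1) s hjs hs, h2 j s (by omega) hs, hc (j + 1) hj (by omega),
      sum_Ioc_succ_top (Nat.zero_le j), hE.top, sum_sub_distrib (s := Ioc (j + 1) s),
      sum_sub_distrib (s := Ioc j s), e1]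
    linear_combination -e2

theorem isGTPattern (hH : H.IsLRHive n) (hE : IsEvacuation n H (emptyTruncated n H) K a) :
    IsGTPattern n K.α := by
  obtain ⟨G, hG, h1, h2⟩ := hE.exists_dual hH
  -- In the dual array the rows `0` are the `β`-labels of `H`. They interlace by the `U`- and
  -- `L`-inequalities of `H`.
  have key := isGTPattern_of_interlace
    (a := fun s i j => G i j s - G i (j - 1) s + (K.γ j j - K.β j n))
    (fun s hs => hG.isPromotion (fun j => K.γ j j - K.β j n) s hs) (fun s hs j hj hjs => by
      rw [h2 j s hj hjs hs.le, h2 j (s + 1) hj (by omega) hs, h2 (j + 1) (s + 1) (by omega)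
        (by omega) hs]
      have e1 := hH.isWeakHive.rhombus (j - 1) s (by omega) hs
      have e2 := hH.U_nonneg j (s + 1) hj (by omega) hs
      have e3 := hH.L_nonneg j (s + 1) hj (by omega) hs
      rw [Nat.sub_add_cancel hj] at e1
      simp only [U, L, Nat.add_sub_cancel] at e2 e3
      omega)
  constructor
  · intro i j hij hj
    rw [← h1 i j (by omega) hj, ← h1 (i + 1) j hij hj]
    exact key.up i j hij hj
  · intro i j hij hj
    rw [← h1 i j hij hj.le, ← h1 (i + 1) (j + 1) (by omega) hj]
    exact key.right i j hij hj

theorem sigma_eq (hH : H.IsLRHive n) (hE : IsEvacuation n H (emptyTruncated n H) K a)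
    (hK : K.IsLRHive n) : sigma n K = H := by
  obtain ⟨G, hG, h1, h2⟩ := hE.exists_dual hH
  obtain ⟨b, hF⟩ := hK.exists_isEvacuation_sigma
  have hL : (sigma n K).IsLRHive n := hF.isLRHive hK (hF.isGTPattern hK)
  have hoct := isOctahedronArray_of_promotion hF.promotion hF.sum_eq_zero
  -- On the face `r = n` both arrays are partial sums of the `α`-labels of `K` with the same
  -- normalization.
  have heq := hoct.eq_of_eq_face hG (fun i j hij hj => by
    simp only [hF.top]
    induction j, hij using Nat.le_induction with
    | base => rw [Ioc_self, sum_empty, hG.wall_left i n hj le_rfl]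
    | succ j hij ih =>
      have := h1 i (j + 1) (by omega) hj
      rw [Nat.add_sub_cancel] at this
      rw [sum_Ioc_succ_top hij, ih (by omega), ← this]
      ring)
  have hb : ∀ j s, 1 ≤ j → j ≤ s → s ≤ n → b s 0 j = H.β j s := by
    intro j s hj hjs hs
    obtain ⟨j, rfl⟩ : ∃ k, j = k + 1 := ⟨j - 1, by omega⟩
    have e1 := heq 0 (j + 1) s (by omega) hjs hs
    have e2 := heq 0 j s (by omega) (by omega) hs
    have e3 := h2 (j + 1) s hj hjs hs
    rw [sum_Ioc_succ_top (Nat.zero_le j), e2] at e1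
    rw [Nat.add_sub_cancel] at e3
    omega
  have hα : ∀ i s, i < s → s ≤ n → (sigma n K).α i s = H.α i s := by
    intro i s his hs
    rw [hF.alpha_eq his hs, hE.beta_eq (by omega) hs le_rfl, hE.top]
    -- The increments recorded by the second application are `β k s - β k (s - 1)`, which by the
    -- rhombus condition are the gradients `U` of `H`.
    induction i with
    | zero => simp
    | succ i ih =>
      have e := hH.isWeakHive.rhombus i (s - 1) (by omega) (by omega)
      rw [Nat.sub_add_cancel (by omega)] at e
      rw [sum_Icc_succ_top (by omega), hb (i + 1) s (by omega) (by omega) hs,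
        hb (i + 1) (s - 1) (by omega) (by omega) (by omega), ← add_assoc, ih (by omega)]
      omega
  have hβ : ∀ i s, 1 ≤ i → i ≤ s → s ≤ n → (sigma n K).β i s = H.β i s := fun i s hi his hs => by
    rw [hF.beta_eq hi his hs, hb i s hi his hs]
  ext i s
  · by_cases c : i < s ∧ s ≤ n
    · exact hα i s c.1 c.2
    · rw [hL.alpha_off i s c, hH.alpha_off i s c]
  · by_cases c : 1 ≤ i ∧ i ≤ s ∧ s ≤ n
    · exact hβ i s c.1 c.2.1 c.2.2
    · rw [hL.beta_off i s c, hH.beta_off i s c]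
  · by_cases c : 1 ≤ i ∧ i ≤ s ∧ s ≤ n
    · rw [← hL.triangle_up i s c.1 c.2.1 c.2.2, ← hH.triangle_up i s c.1 c.2.1 c.2.2,
        hα _ _ (by omega) c.2.2, hβ i s c.1 c.2.1 c.2.2]
    · rw [hL.gamma_off i s c, hH.gamma_off i s c]

end IsEvacuation

end EdgeLabelling

theorem theorem9p4 (n : ℕ) (H : EdgeLabelling) (hH : H.IsLRHive n) :
    (H.sigma n).IsLRHive n ∧
      (∀ k, 1 ≤ k → k ≤ n →
        (H.sigma n).lam k = H.lam k ∧
        (H.sigma n).mu k = H.nu n k ∧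
        (H.sigma n).nu n k = H.mu k) ∧
      (H.sigma n).sigma n = H := by
  obtain ⟨a, hE⟩ := hH.exists_isEvacuation_sigma
  have hK := hE.isLRHive hH (hE.isGTPattern hH)
  refine ⟨hK, fun k hk hkn => ⟨hE.gamma_diag_eq hk hkn, ?_, ?_⟩, hE.sigma_eq hH hK⟩
  · have := hE.alpha_eq (show 0 < k by omega) hkn
    rw [Icc_eq_empty (by omega), sum_empty, add_zero] at this
    exact this
  · have := hE.beta_eq hk hkn le_rfl
    rw [hE.top] at this
    exact this
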